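/- **Setting.** Let $\mathrm e_k^{(j)}$ ($k\ge 4$ even, $0\le j\le k-2$) be free noncommuting letters of degree $k$, possibly together with further free letters arranged in finite-dimensional $\mathfrak{sl}_2$ multiplets of positive degree (finitely many in each degree). On the completed free algebra on these letters let $\mathrm e_0$, $\mathrm e_0^\vee$ be the derivations with $\mathrm e_0\colon \mathrm e_k^{(j)}\mapsto \mathrm e_k^{(j+1)}$ (and $\mathrm e_k^{(k-1)}=0$) and $\mathrm e_0^\vee\colon \mathrm e_k^{(j)}\mapsto j(k-1-j)\,\mathrm e_k^{(j-1)}$ (and likewise on the further multiplets, with their dimension in place of $k-1$), and let $\mathrm e_k$ be left multiplication by $\mathrm e_k^{(0)}$. All identities below are identities of operators on the completed free algebra that do not lower the degree; $x^{(j)}=\mathrm{ad}_{\mathrm e_0}^j x$. For each even $k\ge4$ let $\mathcal B_k$ be a finite set of level-one holomorphic cusp forms of weight $k$ (e.g. the normalised Hecke eigenforms), and for $\Delta\in\mathcal B_k$ let $\mathrm e_{\Delta^\pm}$ be operators with $[\mathrm e_0^\vee,\mathrm e_{\Delta^\pm}]=0$, $\mathrm e_{\Delta^\pm}^{(k-1)}=0$.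 Call a family of operators admissible if each raises the degree by at least $1$ and, for every $D$, all but finitely many raise it by at least $D$; the families $\mathrm e_{\Delta^+}$ and $\mathrm e_{\Delta^-}$ are assumed admissible. For $\operatorname{Im}\tau>0$ let ${\rm G}_k(\tau)=\sum_{(m,n)\ne(0,0)}(m\tau+n)^{-k}$, $\nu_{j,k}=(2\pi i)^{1+j-k}\tau^j{\rm G}_k(\tau)$, $\nu_{j,\Delta}=(2\pi i)^{1+j}\tau^j\Delta(\tau)$, and $$\mathbb A_+=\sum_{k}\sum_{j=0}^{k-2}\tfrac{(-1)^j(k-1)}{j!}\Big[\nu_{j,k}\,\mathrm e_k^{(j)}+\sum_{\Delta\in\mathcal B_k}\nu_{j,\Delta}\,\mathrm e_{\Delta^+}^{(j)}\Big]d\tau,\qquad \mathbb A_-=\sum_{k}\sum_{j=0}^{k-2}\tfrac{k-1}{j!}\Big[\overline{\nu_{j,k}}\,\mathrm e_k^{(j)}+\sum_{\Delta\in\mathcal B_k}\overline{\nu_{j,\Delta}}\,\mathrm e_{\Delta^-}^{(j)}\Big]d\bar\tau .$$ Let $\mathbb I_+(\tau)=1+\int_\tau^{i\infty}\mathbb A_+(\tau_1)+\int_\tau^{i\infty}\big(\int_{\tau_1}^{i\infty}\mathbb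 A_+(\tau_2)\big)\mathbb A_+(\tau_1)+\cdots$ and, with reversed ordering, $\widetilde{\mathbb I}_-(\tau)=1+\int_{\bar\tau}^{-i\infty}\mathbb A_-(\tau_1)+\int_{\bar\tau}^{-i\infty}\mathbb A_-(\tau_1)\big(\int_{\bar\tau_1}^{-i\infty}\mathbb A_-(\tau_2)\big)+\cdots$, with tangential base point regularisation $\int_\tau^{i\infty}\tau_1^n d\tau_1=-\tau^{n+1}/(n+1)$. Put $$\hat N=-\mathrm e_0+\sum_{k\ge4\text{ even}}(k-1)\tfrac{{\rm B}_k}{k!}\,\mathrm e_k,\qquad {\rm U}(\tau)=\exp\!\big(-\tfrac{\mathrm e_0^\vee}{4\pi\operatorname{Im}\tau}\big)\exp(2\pi i\bar\tau\,\mathrm e_0).$$ Let $\hat z=(\hat z_i)$ and $\hat\sigma=(\hat\sigma_i)$ be admissible families of operators indexed by a set $\mathcal I$ consisting of the odd integers $\ge3$ and an arbitrary set of further indices $\varpi$. For complex coefficients $c(i_1\cdots i_\ell)$ with $c(\emptyset)=1$ (in the application, single-valued multiple zeta values and their extensions by periods of cusp forms) let $\mathbb M(x)=\sum c(i_1\cdots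 i_\ell)\,x_{i_1}\cdots x_{i_\ell}$, summed over all words in $\mathcal I$, and $$R[\mathbb J^{\rm eqv}(\mathrm e_k;\tau)]={\rm U}(\tau)\,\mathbb M(\hat z)^{-1}\,\widetilde{\mathbb I}_-(\tau)\,\mathbb M(\hat\sigma)\,\mathbb I_+(\tau)\,{\rm U}(\tau)^{-1}.$$ **Theorem.** All these series and regularised integrals converge coefficientwise, ${\rm U}(\tau)$ and $\mathbb M(\hat z)$ are invertible, and for all $\tau$ with $\operatorname{Im}\tau>0$: 1. ${\rm U}(\tau+1)={\rm U}(\tau)\,e^{2\pi i\mathrm e_0}$; 2. $\mathbb I_+(\tau+1)=e^{2\pi i\hat N}\,\mathbb I_+(\tau)\,e^{2\pi i\mathrm e_0}$; 3. $\widetilde{\mathbb I}_-(\tau+1)=e^{-2\pi i\mathrm e_0}\,\widetilde{\mathbb I}_-(\tau)\,e^{-2\pi i\hat N}$; 4. $R[\mathbb J^{\rm eqv}(\mathrm e_k;\tau+1)]={\rm U}(\tau)\,e^{2\pi i\mathrm e_0}\mathbb M(\hat z)^{-1}e^{-2\pi i\mathrm e_0}\,\widetilde{\mathbb I}_-(\tau)\,e^{-2\pi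 i\hat N}\mathbb M(\hat\sigma)e^{2\pi i\hat N}\,\mathbb I_+(\tau)\,{\rm U}(\tau)^{-1}$. Consequently $R[\mathbb J^{\rm eqv}(\mathrm e_k;\tau)]$ is invariant under $\tau\mapsto\tau+1$ whenever $$e^{2\pi i\mathrm e_0}\mathbb M(\hat z)^{-1}e^{-2\pi i\mathrm e_0}=\mathbb M(\hat z)^{-1}\quad\text{and}\quad e^{-2\pi i\hat N}\mathbb M(\hat\sigma)e^{2\pi i\hat N}=\mathbb M(\hat\sigma).$$ The first condition holds if all $\hat z_i$ are $\mathfrak{sl}_2$-invariant ($[\mathrm e_0,\hat z_i]=[\mathrm e_0^\vee,\hat z_i]=0$), the second if $[\hat N,\hat\sigma_i]=0$ for all $i\in\mathcal I$; so under both assumptions $R[\mathbb J^{\rm eqv}]$ is $T$-invariant. The same statements hold after specialising to Tsunogai's derivations, i.e. with degree-non-lowering operators on $\mathbb C\langle\langle a,b\rangle\rangle$ ($a,b$ of degree $1$), with $\mathrm e_0,\mathrm e_0^\vee,\mathrm e_k$ replaced by the derivations $\epsilon_0\colon a\mapsto b,\ b\mapsto0$; $\epsilon_0^\vee\colon a\mapsto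 0,\ b\mapsto a$; $\epsilon_k\colon a\mapsto\mathrm{ad}_a^k b,\ b\mapsto\sum_{j=0}^{k/2-1}(-1)^j[\mathrm{ad}_a^jb,\mathrm{ad}_a^{k-1-j}b]$, without cusp forms ($\mathrm e_{\Delta^\pm}\to0$) and with $\mathcal I$ the odd integers $\ge3$. -/

import Mathlib

open Complex MatrixGroups Polynomial Asymptotics Filter

noncomputable section

/-! ## Completed free algebras and their graded operators -/

/-- An alphabet whose letters carry a positive integer degree, with finitely many letters
in each degree. -/
class GradedAlphabet (X : Type) where
  deg : X → ℕ
  one_le_deg : ∀ x, 1 ≤ deg x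
  finite_deg_le : ∀ n, {x | deg x ≤ n}.Finite

/-- Words (noncommutative monomials) in the letters `X`. -/
def Word (X : Type) : Type := FreeMonoid X

namespace Word

variable {X : Type}

/-- The list of letters of a word. -/
def letters (w : Word X) : List X := FreeMonoid.toList w

instance : DecidableEq (Word X) := Classical.decEq _

variable [GradedAlphabet X]

/-- The degree of a word is the sum of the degrees of its letters. -/
def deg (w : Word X) : ℕ := (w.letters.map GradedAlphabet.deg).sum

/-- Words are preordered by decreasing degree. -/
instance : Preorder (Word X) := Preorder.lift fun w => OrderDual.toDual w.deg

theorem le_def {u w : Word X} : u ≤ w ↔ w.deg ≤ u.deg := Iff.rfl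

/-- There are finitely many words of bounded degree. -/
theorem finite_deg_le (n : ℕ) : {w : Word X | w.deg ≤ n}.Finite := by
  have hS := GradedAlphabet.finite_deg_le (X := X) n
  have : Finite {x : X | GradedAlphabet.deg x ≤ n} := hS
  have hlen := List.finite_length_le {x : X | GradedAlphabet.deg x ≤ n} n
  refine Set.Finite.subset (hlen.image
    (fun l => (FreeMonoid.ofList (l.map Subtype.val) : FreeMonoid X))) ?_
  intro (w : Word X) hw
  have hmem : ∀ x ∈ w.letters, GradedAlphabet.deg x ≤ n := fun x hx =>
    (List.le_sum_of_mem (List.mem_map_of_mem hx)).trans hw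
  refine ⟨w.letters.attachWith (fun x => x ∈ {x : X | GradedAlphabet.deg x ≤ n}) hmem, ?_, ?_⟩
  · have h1 : w.letters.length • 1 ≤ (w.letters.map GradedAlphabet.deg).sum := by
      have := List.card_nsmul_le_sum (w.letters.map (GradedAlphabet.deg (X := X))) 1 (by
        intro y hy
        obtain ⟨x, -, rfl⟩ := List.mem_map.1 hy
        exact GradedAlphabet.one_le_deg x)
      simpa using this
    have h2 : (w.letters.map GradedAlphabet.deg).sum ≤ n := hw
    show (w.letters.attachWith _ hmem).length ≤ n
    rw [List.length_attachWith]
    simp only [smul_eq_mul, mul_one] at h1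
    omega
  · simp [letters]
    rfl

instance : LocallyFiniteOrder (Word X) :=
  LocallyFiniteOrder.ofFiniteIcc fun u _ =>
    (finite_deg_le u.deg).subset fun _ hv => le_def.1 hv.1

end Word

/-- Noncommutative polynomials: the free associative algebra on the letters `X`, which is the
universal enveloping algebra of the free Lie algebra on `X`. -/
abbrev NCPoly (X : Type) : Type := MonoidAlgebra ℂ (FreeMonoid X)

/-- A letter, as a noncommutative polynomial. -/
def NCPoly.letter {X : Type} (x : X) : NCPoly X := MonoidAlgebra.of ℂ (FreeMonoid X) (FreeMonoid.of x)

/-- A list of letters, as a noncommutative monomial. -/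
def NCPoly.monomial {X : Type} (l : List X) : NCPoly X := (l.map NCPoly.letter).prod

/-- The algebra of operators on the completed free algebra `ℂ⟨⟨X⟩⟩` that do not lower the
degree. An operator `T` is given by its matrix: the entry `T u w` is the coefficient of the word
`u` in the image of the word `w`, and it vanishes unless `deg w ≤ deg u`. The product is the
matrix product, i.e. composition of operators. -/
abbrev Op (X : Type) [GradedAlphabet X] : Type := IncidenceAlgebra ℂ (Word X)

section Operators

variable {X : Type} [GradedAlphabet X]

/-- Entrywise convergence, i.e. convergence of each coefficient. -/
instance : TopologicalSpace (Op X) :=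
  TopologicalSpace.induced (fun (T : Op X) (u w : Word X) => T u w) inferInstance

/-- The operator with prescribed images of words (all of whose terms of degree lower than that
of the word are dropped; there are none in the uses below). -/
def opOf (T : Word X → NCPoly X) : Op X :=
  open Classical in
  ⟨fun u w => if u ≤ w then (T w).coeff u else 0, fun _ _ h => if_neg h⟩

/-- Left multiplication by a noncommutative polynomial. -/
def leftMul (p : NCPoly X) : Op X := opOf fun w => p * NCPoly.monomial w.letters

/-- The derivation of the free algebra that extends `g`, on a word. -/
def derOnList (g : X → NCPoly X) : List X → NCPoly X
  | [] => 0
  | x :: l => g x * NCPoly.monomial l + NCPoly.letter x * derOnList g l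

/-- The derivation of the free algebra with prescribed values on letters, as an operator. -/
def derivationOp (g : X → NCPoly X) : Op X := opOf fun w => derOnList g w.letters

/-- `ad_x^j y`. -/
def adPow {R : Type} [Ring R] (x : R) (j : ℕ) (y : R) : R := (fun z => ⁅x, z⁆)^[j] y

/-- The exponential series of an operator. -/
def opExp (x : Op X) : Op X := ∑' n : ℕ, ((n.factorial : ℂ)⁻¹) • x ^ n

/-- `x` raises degrees by at least `n`. -/
def RaisesBy (n : ℕ) (x : Op X) : Prop := ∀ u w : Word X, x u w ≠ 0 → w.deg + n ≤ u.deg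

/-- A family of operators of positive degree, only finitely many of which contribute below any
given degree, so that infinite linear combinations of words in them make sense. -/
def Admissible {ι : Type*} (x : ι → Op X) : Prop :=
  (∀ i, RaisesBy 1 (x i)) ∧ ∀ D : ℕ, {i | ¬ RaisesBy D (x i)}.Finite

end Operators

/-! ## The letters `e_k`, and Tsunogai's derivations -/

/-- The even integers `k ≥ 4`. -/
abbrev EvenWt : Type := {k : ℕ // 4 ≤ k ∧ Even k}

/-- The odd integers `w ≥ 3`. -/
abbrev OddWt : Type := {w : ℕ // 3 ≤ w ∧ Odd w}

/-- A choice of operators `e_0`, `e_0^∨` and `e_k` for even `k ≥ 4`. There are two instances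
below: `freeLetters` and `tsunogaiLetters`. -/
structure Letters (X : Type) [GradedAlphabet X] where
  e0 : Op X
  e0v : Op X
  e : EvenWt → Op X

/-- A graded set of further `sl_2` multiplets of free letters, besides those of the `e_k`; it may
be empty. It allows for generators that are independent symbols, such as the `e_Δ` or arithmetic
generators (multiplets of dimension one), next to the letters `e_k`. -/
class ExtraMultiplets (M : Type) where
  dim : M → ℕ
  deg : M → ℕ
  one_le_deg : ∀ m, 1 ≤ deg m
  finite_deg_le : ∀ n, {m | deg m ≤ n}.Finite

/-- There are no further multiplets. -/
instance : ExtraMultiplets Empty where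
  dim := Empty.elim
  deg := Empty.elim
  one_le_deg := fun m => m.elim
  finite_deg_le _ := Set.toFinite _

section Free

variable (M : Type) [ExtraMultiplets M]

/-- The dimension of a multiplet: `k - 1` for that of `e_k`. -/
def multipletDim : EvenWt ⊕ M → ℕ
  | .inl k => k.1 - 1
  | .inr m => ExtraMultiplets.dim m

/-- The degree of a multiplet: `k` for that of `e_k`. -/
def multipletDeg : EvenWt ⊕ M → ℕ
  | .inl k => k.1
  | .inr m => ExtraMultiplets.deg m

/-- The free letters: `e_k^{(j)}` with `k ≥ 4` even and `0 ≤ j ≤ k - 2`, and similarly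
`m^{(j)}` with `0 ≤ j ≤ dim m - 1` for the further multiplets `m`. -/
abbrev FreeAlphabet : Type := Σ m : EvenWt ⊕ M, Fin (multipletDim M m)

instance : GradedAlphabet (FreeAlphabet M) where
  deg x := multipletDeg M x.1
  one_le_deg x := by
    rcases x with ⟨k | m, j⟩
    · exact le_trans (by norm_num) k.2.1
    · exact ExtraMultiplets.one_le_deg m
  finite_deg_le n := by
    have h1 : {k : EvenWt | k.1 ≤ n}.Finite :=
      Set.Finite.of_finite_image ((Set.finite_Iic n).subset (by
        rintro _ ⟨k, hk, rfl⟩; exact hk)) Subtype.val_injective.injOn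
    have h2 := ExtraMultiplets.finite_deg_le (M := M) n
    have hf : {m : EvenWt ⊕ M | multipletDeg M m ≤ n}.Finite := by
      refine ((h1.image Sum.inl).union (h2.image Sum.inr)).subset ?_
      rintro (k | m) hm
      · exact Or.inl ⟨k, hm, rfl⟩
      · exact Or.inr ⟨m, hm, rfl⟩
    have := hf.to_subtype
    refine Set.Finite.subset (Set.finite_range
      fun x : Σ m : {m : EvenWt ⊕ M | multipletDeg M m ≤ n}, Fin (multipletDim M m.1) =>
        (⟨x.1.1, x.2⟩ : FreeAlphabet M)) ?_
    rintro ⟨m, j⟩ hm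
    exact ⟨⟨⟨m, hm⟩, j⟩, rfl⟩

/-- The free case. The letter `e_k` is left multiplication by `e_k^{(0)}`, and `e_0`, `e_0^∨`
are the derivations with `[e_0, e_k^{(j)}] = e_k^{(j+1)}` (zero for `j = k - 2`) and
`[e_0^∨, e_k^{(j)}] = j (k - 1 - j) e_k^{(j-1)}`, and likewise on the other multiplets, with
the dimension in place of `k - 1`. -/
def freeLetters : Letters (FreeAlphabet M) where
  e0 := derivationOp fun x =>
    if h : x.2.1 + 1 < multipletDim M x.1 then NCPoly.letter ⟨x.1, ⟨x.2.1 + 1, h⟩⟩ else 0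
  e0v := derivationOp fun x =>
    ((x.2.1 : ℂ) * ((multipletDim M x.1 : ℂ) - (x.2.1 : ℂ))) •
      NCPoly.letter ⟨x.1, ⟨x.2.1 - 1, lt_of_le_of_lt (Nat.sub_le _ _) x.2.2⟩⟩
  e k := leftMul (NCPoly.letter ⟨.inl k, ⟨0, by
    have := k.2.1
    simp only [multipletDim]
    omega⟩⟩)

end Free

/-- The two generators of the fundamental group Lie algebra of the once-punctured torus. -/
inductive TorusLetter : Type
  | a
  | b

/-- Both `a` and `b` have degree one. -/
instance : GradedAlphabet TorusLetter where
  deg _ := 1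
  one_le_deg _ := le_rfl
  finite_deg_le _ := (Set.finite_range fun t : Bool => cond t TorusLetter.a TorusLetter.b).subset
    fun x _ => by
      cases x
      · exact ⟨true, rfl⟩
      · exact ⟨false, rfl⟩

/-- Tsunogai's derivations of the free Lie algebra on `a, b`, acting on its completed universal
enveloping algebra `ℂ⟨⟨a, b⟩⟩`:
`ε_0 (a) = b`, `ε_0 (b) = 0`, `ε_0^∨ (a) = 0`, `ε_0^∨ (b) = a` and, for even `k ≥ 4`,
`ε_k (a) = ad_a^k b`, `ε_k (b) = ∑_{j=0}^{k/2-1} (-1)^j [ad_a^j b, ad_a^{k-1-j} b]`. -/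
def tsunogaiLetters : Letters TorusLetter where
  e0 := derivationOp fun (x : TorusLetter) => match x with
    | .a => NCPoly.letter TorusLetter.b
    | .b => 0
  e0v := derivationOp fun (x : TorusLetter) => match x with
    | .a => 0
    | .b => NCPoly.letter TorusLetter.a
  e k := derivationOp fun (x : TorusLetter) => match x with
    | .a => adPow (NCPoly.letter TorusLetter.a) k.1 (NCPoly.letter TorusLetter.b)
    | .b => ∑ j ∈ Finset.range (k.1 / 2), (-1 : ℂ) ^ j •
        ⁅adPow (NCPoly.letter TorusLetter.a) j (NCPoly.letter TorusLetter.b),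
          adPow (NCPoly.letter TorusLetter.a) (k.1 - 1 - j) (NCPoly.letter TorusLetter.b)⁆

/-! ## Integration kernels -/

/-- The holomorphic Eisenstein series `G_k(τ) = ∑_{(m,n) ≠ (0,0)} (m τ + n)^{-k}`. -/
def Gk (k : ℕ) (τ : ℂ) : ℂ :=
  ∑' p : {p : ℤ × ℤ // p ≠ 0}, 1 / ((p.1.1 : ℂ) * τ + (p.1.2 : ℂ)) ^ k

/-- The kernel `ν_{j,k}(τ) = (2πi)^{1+j-k} τ^j G_k(τ)`. -/
def nuEis (j k : ℕ) (τ : ℂ) : ℂ :=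
  (2 * Real.pi * I) ^ (1 + (j : ℤ) - (k : ℤ)) * τ ^ j * Gk k τ

/-- The kernel `ν_{j,Δ}(τ) = (2πi)^{1+j} τ^j Δ(τ)` of a level-one holomorphic cusp form. -/
def nuCusp (j : ℕ) {k : ℤ} (Δ : CuspForm 𝒮ℒ k) (τ : ℂ) : ℂ :=
  (2 * Real.pi * I) ^ (1 + j) * τ ^ j * Δ (UpperHalfPlane.ofComplex τ)

/-- Finite sets of level-one holomorphic cusp forms, one for each even weight `k ≥ 4` (for
instance the bases of normalised Hecke eigenforms). -/
abbrev CuspForms : Type := ∀ k : EvenWt, Finset (CuspForm 𝒮ℒ (k.1 : ℤ))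

/-- An operator `e_Δ` for every cusp form `Δ`. -/
abbrev CuspLetters (X : Type) [GradedAlphabet X] : Type :=
  ∀ k : EvenWt, CuspForm 𝒮ℒ (k.1 : ℤ) → Op X

section Series

variable {X : Type} [GradedAlphabet X] (L : Letters X) (B : CuspForms) (eP eM : CuspLetters X)

/-- The operators `e_Δ`, for `Δ` of weight `k`, are lowest-weight vectors of `(k-1)`-dimensional
`sl_2` multiplets, just as `e_k` is, and they form an admissible family. -/
structure IsCuspMultiplets (eD : CuspLetters X) : Prop where
  lowest : ∀ k, ∀ Δ ∈ B k, ⁅L.e0v, eD k Δ⁆ = 0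
  nilpotent : ∀ k, ∀ Δ ∈ B k, adPow L.e0 (k.1 - 1) (eD k Δ) = 0
  admissible : Admissible fun p : Σ k : EvenWt, B k => eD p.1 p.2.1

/-- The weight-`k` part of the `(1,0)`-form `A_+` (coefficient of `dτ`). -/
def AplusWt (k : EvenWt) (τ : ℂ) : Op X :=
  ∑ j ∈ Finset.range (k.1 - 1), ((-1 : ℂ) ^ j * ((k.1 : ℂ) - 1) / (j.factorial : ℂ)) •
    (nuEis j k.1 τ • adPow L.e0 j (L.e k)
      + ∑ Δ ∈ B k, nuCusp j Δ τ • adPow L.e0 j (eP k Δ))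

/-- The `(1,0)`-form `A_+` (coefficient of `dτ`). -/
def Aplus (τ : ℂ) : Op X := ∑' k : EvenWt, AplusWt L B eP k τ

/-- The weight-`k` part of the `(0,1)`-form `A_-` (coefficient of the differential of the complex
conjugate of `τ`). -/
def AminusWt (k : EvenWt) (τ : ℂ) : Op X :=
  ∑ j ∈ Finset.range (k.1 - 1), (((k.1 : ℂ) - 1) / (j.factorial : ℂ)) •
    ((starRingEnd ℂ) (nuEis j k.1 τ) • adPow L.e0 j (L.e k)
      + ∑ Δ ∈ B k, (starRingEnd ℂ) (nuCusp j Δ τ) • adPow L.e0 j (eM k Δ))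

/-- The `(0,1)`-form `A_-`. -/
def Aminus (τ : ℂ) : Op X := ∑' k : EvenWt, AminusWt L B eM k τ

end Series

/-! ## Regularised integrals and path-ordered exponentials -/

/-- On every vertical half-line in the upper half-plane, `F` is exponentially close to the
polynomial `P` (the same one for all of them) towards `i∞`. -/
def HasPolyAsymp (F : ℂ → ℂ) (P : ℂ[X]) : Prop :=
  ∃ c : ℝ, 0 < c ∧ ∀ τ : ℂ, 0 < τ.im →
    (fun t : ℝ => F (τ + t * I) - P.eval (τ + t * I)) =O[atTop] fun t : ℝ => Real.exp (-c * t)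

open Classical in
/-- The polynomial asymptotics of `F` at the cusp, if it exists (it is then unique). -/
def regPoly (F : ℂ → ℂ) : ℂ[X] := if h : ∃ P, HasPolyAsymp F P then h.choose else 0

/-- The integral `∫_τ^{i∞} F(τ₁) dτ₁` with tangential base point regularisation: the polynomial
part is integrated by the rule `∫_τ^{i∞} τ₁^n dτ₁ = - τ^{n+1} / (n+1)`, and the exponentially
decaying remainder is integrated along the vertical half-line. -/
def regInt (F : ℂ → ℂ) (τ : ℂ) : ℂ :=
  (∫ t in Set.Ioi (0 : ℝ), (F (τ + t * I) - (regPoly F).eval (τ + t * I)) * I)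
    - (regPoly F).sum fun n a => a * τ ^ (n + 1) / (n + 1)

/-- The regularised integral of `F` exists. -/
def RegIntegrable (F : ℂ → ℂ) : Prop :=
  (∃ P, HasPolyAsymp F P) ∧ ∀ τ : ℂ, 0 < τ.im →
    MeasureTheory.IntegrableOn
      (fun t : ℝ => F (τ + t * I) - (regPoly F).eval (τ + t * I)) (Set.Ioi 0)

section PathOrdered

variable {X : Type} [GradedAlphabet X]

open Classical in
/-- `∫_τ^{i∞} F(τ₁) dτ₁` for operator-valued `F`, entry by entry. -/
def opRegInt (F : ℂ → Op X) (τ : ℂ) : Op X :=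
  ⟨fun u w => if u ≤ w then regInt (fun z => F z u w) τ else 0, fun _ _ h => if_neg h⟩

open Classical in
/-- The integral of `F(τ₁)` against the differential of the complex conjugate of `τ₁`, from the
complex conjugate of `τ` to `-i∞`, for operator-valued `F`: entry by entry, the complex conjugate
of the integral from `τ` to `i∞` of the complex conjugate of `F`. -/
def opRegIntConj (F : ℂ → Op X) (τ : ℂ) : Op X :=
  ⟨fun u w => if u ≤ w then
      (starRingEnd ℂ) (regInt (fun z => (starRingEnd ℂ) (F z u w)) τ) else 0,
    fun _ _ h => if_neg h⟩

variable (L : Letters X) (B : CuspForms) (eP eM : CuspLetters X)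

/-- The `n`-fold iterated integral in `I_+`; the form at the innermost integration variable, the
one furthest from `τ`, stands to the left. -/
def IplusTerm : ℕ → ℂ → Op X
  | 0 => fun _ => 1
  | n + 1 => opRegInt fun z => IplusTerm n z * Aplus L B eP z

/-- `I_+(τ)`, the path-ordered exponential of `∫_τ^{i∞} A_+`. -/
def Iplus (τ : ℂ) : Op X := ∑' n : ℕ, IplusTerm L B eP n τ

/-- The `n`-fold iterated integral in the reversed series `Ĩ_-`; the form at the integration
variable furthest from `τ` stands to the right. -/
def ItildeMinusTerm : ℕ → ℂ → Op X
  | 0 => fun _ => 1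
  | n + 1 => opRegIntConj fun z => Aminus L B eM z * ItildeMinusTerm n z

/-- `Ĩ_-(τ)`, the path-ordered exponential, with reversed ordering, of the integral of `A_-` from
the complex conjugate of `τ` to `-i∞`. -/
def ItildeMinus (τ : ℂ) : Op X := ∑' n : ℕ, ItildeMinusTerm L B eM n τ

/-- The terms `(k-1) (B_k / k!) e_k` of `N̂`. -/
def NhatTerm (k : EvenWt) : Op X :=
  (((k.1 : ℂ) - 1) * ((bernoulli k.1 : ℚ) : ℂ) / (k.1.factorial : ℂ)) • L.e k

/-- `N̂ = - e_0 + ∑_{k ≥ 4 even} (k-1) (B_k / k!) e_k`. -/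
def Nhat : Op X := -L.e0 + ∑' k : EvenWt, NhatTerm L k

/-- `exp(2πi x)`. -/
def exp2piI (x : Op X) : Op X := opExp ((2 * Real.pi * I : ℂ) • x)

/-- `exp(-2πi x)`. -/
def expNeg2piI (x : Op X) : Op X := opExp ((-(2 * Real.pi * I) : ℂ) • x)

/-- `U(τ) = exp(- e_0^∨ / (4y)) exp(2πi τ̄ e_0)` with `y = π Im τ`. -/
def USL2 (τ : ℂ) : Op X :=
  opExp ((-(1 / (4 * Real.pi * τ.im)) : ℂ) • L.e0v)
    * opExp ((2 * Real.pi * I * (starRingEnd ℂ) τ : ℂ) • L.e0)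

/-- The series `M(x) = ∑ c(i_1 … i_ℓ) x_{i_1} ⋯ x_{i_ℓ}` over all words `i_1 … i_ℓ` in the
index set `ι`. -/
def Mseries {ι : Type*} (c : List ι → ℂ) (x : ι → Op X) : Op X :=
  ∑' l : List ι, c l • (l.map x).prod

variable {ι : Type*} (c : List ι → ℂ) (z σ : ι → Op X)

/-- The generating series
`R[J^eqv](τ) = U(τ) M(ẑ)^{-1} Ĩ_-(τ) M(σ̂) I_+(τ) U(τ)^{-1}`. -/
def RJeqv (τ : ℂ) : Op X :=
  USL2 L τ * Ring.inverse (Mseries c z) * ItildeMinus L B eM τ * Mseries c σ * Iplus L B eP τ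
    * Ring.inverse (USL2 L τ)

/-- All series and regularised integrals in the definitions of the generating series converge,
and the inverses in them exist. -/
structure SeriesWellDefined : Prop where
  summable_Gk : ∀ (k : EvenWt) (τ : ℂ), 0 < τ.im → Summable
    fun p : {p : ℤ × ℤ // p ≠ 0} => 1 / ((p.1.1 : ℂ) * τ + (p.1.2 : ℂ)) ^ k.1
  summable_exp : ∀ x : Op X, Summable fun n : ℕ => ((n.factorial : ℂ)⁻¹) • x ^ n
  summable_Aplus : ∀ τ : ℂ, 0 < τ.im → Summable fun k : EvenWt => AplusWt L B eP k τ
  summable_Aminus : ∀ τ : ℂ, 0 < τ.im → Summable fun k : EvenWt => AminusWt L B eM k τ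
  summable_Nhat : Summable (NhatTerm L)
  regIntegrable_Iplus : ∀ (n : ℕ) (u w : Word X),
    RegIntegrable fun τ => (IplusTerm L B eP n τ * Aplus L B eP τ) u w
  regIntegrable_ItildeMinus : ∀ (n : ℕ) (u w : Word X),
    RegIntegrable fun τ => (starRingEnd ℂ) ((Aminus L B eM τ * ItildeMinusTerm L B eM n τ) u w)
  summable_Iplus : ∀ τ : ℂ, 0 < τ.im → Summable fun n => IplusTerm L B eP n τ
  summable_ItildeMinus : ∀ τ : ℂ, 0 < τ.im → Summable fun n => ItildeMinusTerm L B eM n τ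
  summable_Mz : Summable fun l : List ι => c l • (l.map z).prod
  summable_Mσ : Summable fun l : List ι => c l • (l.map σ).prod
  isUnit_Mz : IsUnit (Mseries c z)
  isUnit_U : ∀ τ : ℂ, 0 < τ.im → IsUnit (USL2 L τ)

/-- The `T`-transformation laws of the generating series. -/
structure TTransformation : Prop where
  U_T : ∀ τ : ℂ, 0 < τ.im → USL2 L (τ + 1) = USL2 L τ * exp2piI L.e0
  Iplus_T : ∀ τ : ℂ, 0 < τ.im →
    Iplus L B eP (τ + 1) = exp2piI (Nhat L) * Iplus L B eP τ * exp2piI L.e0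
  ItildeMinus_T : ∀ τ : ℂ, 0 < τ.im →
    ItildeMinus L B eM (τ + 1) = expNeg2piI L.e0 * ItildeMinus L B eM τ * expNeg2piI (Nhat L)
  RJeqv_T : ∀ τ : ℂ, 0 < τ.im →
    RJeqv L B eP eM c z σ (τ + 1) =
      USL2 L τ * (exp2piI L.e0 * Ring.inverse (Mseries c z) * expNeg2piI L.e0)
        * ItildeMinus L B eM τ * (expNeg2piI (Nhat L) * Mseries c σ * exp2piI (Nhat L))
        * Iplus L B eP τ * Ring.inverse (USL2 L τ)

/-- The condition `e^{2πi e_0} M(ẑ)^{-1} e^{-2πi e_0} = M(ẑ)^{-1}`. -/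
def MzCondition : Prop :=
  exp2piI L.e0 * Ring.inverse (Mseries c z) * expNeg2piI L.e0 = Ring.inverse (Mseries c z)

/-- The condition `e^{-2πi N̂} M(σ̂) e^{2πi N̂} = M(σ̂)`. -/
def MσCondition : Prop :=
  expNeg2piI (Nhat L) * Mseries c σ * exp2piI (Nhat L) = Mseries c σ

/-- `sl_2`-invariance of all members of a family of operators. -/
def SL2Invariant (x : ι → Op X) : Prop := ∀ i, ⁅L.e0, x i⁆ = 0 ∧ ⁅L.e0v, x i⁆ = 0

/-- All members of a family of operators commute with `N̂`. -/
def CommutesWithNhat (x : ι → Op X) : Prop := ∀ i, ⁅Nhat L, x i⁆ = 0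

/-- `T`-invariance of `R[J^eqv]`. -/
def TInvariant : Prop :=
  ∀ τ : ℂ, 0 < τ.im → RJeqv L B eP eM c z σ (τ + 1) = RJeqv L B eP eM c z σ τ

end PathOrdered

end

/-!
# `T`-invariance of the generating series of equivariant iterated Eisenstein integrals

An operator that does not lower the degree is determined by its truncations to the finitely many
words of degree at most `N`. Truncation (`trunc`) is a continuous algebra homomorphism to finite
matrices, so every series and every identity can be checked on finite matrices, where the operators
`e_k`, `e_Δ` of positive degree become strictly triangular for the degree (`MatrixRaises`) and
path-ordered exponentials become finite sums.

For matrices, let `J` be the path-ordered exponential of the connection `A = A_+`, let `E` and `N`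
be the images of `e_0` and `N̂`. Three facts carry the law `J(τ+1) = exp(2πiN) J(τ) exp(2πiE)`.
* Since `ad_E^{k-1}` annihilates the Eisenstein and cuspidal letters of weight `k`, the polynomials
  in `τ` that occur in `A` are exponentials of `ad_E`: `A(τ) = exp(-2πiτE) Φ(τ) exp(2πiτE)` with `Φ`
  of period one (`exp_conj_eq_sum_adPow`), so that `A(τ+1)` is conjugate to `A(τ)` by the constant
  matrix `exp(2πiE)`.
* `J` solves `J' = -J A` along vertical lines, and at the cusp it is exponentially close to a matrix
  of polynomials: the path-ordered exponential, with base point `0`, of the form obtained from `A`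
  by replacing each modular form by its zeroth Fourier coefficient. For `G_k` this coefficient is
  `-(2πi)^k B_k / k!`, which makes the polynomial matrix equal to `exp(2πiτN) exp(2πiτE)`
  (`exists_connMatrix_asymp`, `matrixPathPoly_eval`).
* A solution of `D' = -D A` along vertical lines that tends to zero at the cusp vanishes, one column
  at a time in the order given by the degree
  (`eq_zero_of_vertical_hasDerivAt_of_tendsto`). Both sides of the law solve the equation and have
  the same asymptotics at the cusp.

The law for the reversed series with `A_-` is the same theorem for the adjoint matrices, whose
degree filtration is reversed. The law for `U` and the statements on `M(ẑ)` and `M(σ̂)` are algebra.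

The only input on the letters is `IsEisensteinMultiplets`: the operator `e_k` raises the degree by
`k`, and `ad_{e_0}^{k-1} e_k = 0`. For free letters both hold by construction. For Tsunogai's
derivations, `ε_k` has weight `k - 2` and is annihilated by `ad ε_0^∨`; as `ε_0` is nilpotent on
words of bounded degree, the standard `sl_2` computation `lie_adPow_succ` forces
`ad_{ε_0}^{k-1} ε_k = 0`.
-/

noncomputable section

/-! ### The topological algebra of operators -/

section OpTopology

variable {X : Type} [GradedAlphabet X]

instance : Algebra ℂ (Op X) :=
  Algebra.ofModule
    (fun c x y => by
      ext u w _
      simp [Finset.mul_sum, mul_assoc])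
    (fun c x y => by
      ext u w _
      simp [Finset.mul_sum, mul_left_comm])

instance : IsScalarTower ℂ (Op X) (Op X) := ⟨fun c x y => smul_mul_assoc c x y⟩

instance : SMulCommClass ℂ (Op X) (Op X) := ⟨fun c x y => (mul_smul_comm c x y).symm⟩

theorem op_isInducing : Topology.IsInducing fun (T : Op X) (u w : Word X) => T u w := ⟨rfl⟩

instance : T2Space (Op X) :=
  (Topology.IsEmbedding.mk op_isInducing fun _ _ h => DFunLike.coe_injective h).t2Space

theorem continuous_op_apply (u w : Word X) : Continuous fun T : Op X => T u w :=
  (continuous_apply w).comp ((continuous_apply u).comp op_isInducing.continuous)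

theorem continuous_op_iff {Y : Type*} [TopologicalSpace Y] {f : Y → Op X} :
    Continuous f ↔ ∀ u w, Continuous fun y => f y u w := by
  rw [op_isInducing.continuous_iff, continuous_pi_iff]
  exact forall_congr' fun u => continuous_pi_iff

instance : ContinuousAdd (Op X) :=
  ⟨continuous_op_iff.2 fun u w => ((continuous_op_apply u w).comp continuous_fst).add
    ((continuous_op_apply u w).comp continuous_snd)⟩

instance : ContinuousMul (Op X) :=
  ⟨continuous_op_iff.2 fun u w => by
    simp only [IncidenceAlgebra.mul_apply]
    exact continuous_finsetSum _ fun v _ => ((continuous_op_apply u v).comp continuous_fst).mul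
      ((continuous_op_apply v w).comp continuous_snd)⟩

instance : ContinuousNeg (Op X) :=
  ⟨continuous_op_iff.2 fun u w => (continuous_op_apply u w).neg⟩

instance : IsTopologicalRing (Op X) where

/-- Series of operators converge coefficientwise. -/
theorem op_summable_iff {ι : Type*} {f : ι → Op X} :
    Summable f ↔ ∀ u w, Summable fun i => f i u w := by
  constructor
  · exact fun h u w => h.map (⟨⟨fun T : Op X => T u w, rfl⟩, fun _ _ => rfl⟩ : Op X →+ ℂ)
      (continuous_op_apply u w)
  · intro h
    refine ⟨⟨fun u w => ∑' i, f i u w, fun u w huw => ?_⟩, ?_⟩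
    · simp [IncidenceAlgebra.apply_eq_zero_of_not_le huw]
    · let φ : Op X →+ (Word X → Word X → ℂ) := ⟨⟨fun T u w => T u w, rfl⟩, fun _ _ => rfl⟩
      refine (Topology.IsInducing.hasSum_iff (g := φ) op_isInducing _ _).1 ?_
      exact Pi.hasSum.2 fun u => Pi.hasSum.2 fun w => (h u w).hasSum

theorem op_tsum_apply {ι : Type*} {f : ι → Op X} (hf : Summable f) (u w : Word X) :
    (∑' i, f i) u w = ∑' i, f i u w :=
  hf.map_tsum (⟨⟨fun T : Op X => T u w, rfl⟩, fun _ _ => rfl⟩ : Op X →+ ℂ)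
    (continuous_op_apply u w)

end OpTopology

/-! ### Operators raising the degree -/

section Raises

variable {X : Type} [GradedAlphabet X] {m n : ℕ} {x y : Op X}

theorem raisesBy_zero (x : Op X) : RaisesBy 0 x := fun _ _ h =>
  Word.le_def.1 (IncidenceAlgebra.le_of_ne_zero h)

theorem RaisesBy.mono (h : RaisesBy n x) (hmn : m ≤ n) : RaisesBy m x := fun u w hx => by
  have := h u w hx
  omega

theorem RaisesBy.mul (hx : RaisesBy m x) (hy : RaisesBy n y) : RaisesBy (m + n) (x * y) := by
  intro u w h
  rw [IncidenceAlgebra.mul_apply] at h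
  obtain ⟨v, -, hv⟩ := Finset.exists_ne_zero_of_sum_ne_zero h
  have h1 := hx u v (left_ne_zero_of_mul hv)
  have h2 := hy v w (right_ne_zero_of_mul hv)
  omega

theorem RaisesBy.mul_left (hy : RaisesBy n y) (x : Op X) : RaisesBy n (x * y) := by
  simpa using (raisesBy_zero x).mul hy

theorem RaisesBy.mul_right (hx : RaisesBy n x) (y : Op X) : RaisesBy n (x * y) := by
  simpa using hx.mul (raisesBy_zero y)

theorem RaisesBy.add (hx : RaisesBy n x) (hy : RaisesBy n y) : RaisesBy n (x + y) := by
  intro u w h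
  by_cases h1 : x u w = 0
  · exact hy u w fun h2 => h (by simp [h1, h2])
  · exact hx u w h1

theorem RaisesBy.neg (hx : RaisesBy n x) : RaisesBy n (-x) := fun u w h =>
  hx u w fun h2 => h (by simp [h2])

theorem RaisesBy.sub (hx : RaisesBy n x) (hy : RaisesBy n y) : RaisesBy n (x - y) := by
  simpa [sub_eq_add_neg] using hx.add hy.neg

theorem RaisesBy.smul (hx : RaisesBy n x) (c : ℂ) : RaisesBy n (c • x) := fun u w h =>
  hx u w fun h2 => h (by simp [h2])

theorem raisesBy_zero_op : RaisesBy n (0 : Op X) := fun _ _ h => (h rfl).elim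

theorem RaisesBy.sum {ι : Type*} {s : Finset ι} {f : ι → Op X}
    (h : ∀ i ∈ s, RaisesBy n (f i)) : RaisesBy n (∑ i ∈ s, f i) := by
  classical
  induction s using Finset.induction_on with
  | empty => simpa using raisesBy_zero_op
  | insert a s ha ih =>
    rw [Finset.sum_insert ha]
    exact (h a (by simp)).add (ih fun i hi => h i (by simp [hi]))

theorem RaisesBy.pow (hx : RaisesBy 1 x) (n : ℕ) : RaisesBy n (x ^ n) := by
  induction n with
  | zero => exact raisesBy_zero _
  | succ n ih => exact pow_succ x n ▸ ih.mul hx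

theorem RaisesBy.adPow (hy : RaisesBy n y) (x : Op X) (j : ℕ) : RaisesBy n (adPow x j y) := by
  induction j with
  | zero => exact hy
  | succ j ih =>
    rw [_root_.adPow, Function.iterate_succ_apply', ← _root_.adPow, Ring.lie_def]
    exact (ih.mul_left x).sub (ih.mul_right x)

/-- A series of operators converges if below any degree only finitely many terms contribute. -/
theorem op_summable_of_finite {ι : Type*} {f : ι → Op X}
    (h : ∀ D : ℕ, {i | ¬ RaisesBy D (f i)}.Finite) : Summable f :=
  op_summable_iff.2 fun u w => summable_of_hasFiniteSupport <| (h (u.deg + 1)).subset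
    fun i hi hr => by
      have := hr u w hi
      omega

/-- Among the words in an admissible family only finitely many contribute below any degree. -/
theorem Admissible.finite_prod {ι : Type*} {x : ι → Op X} (hx : Admissible x) (c : List ι → ℂ)
    (D : ℕ) : {l : List ι | ¬ RaisesBy D (c l • (l.map x).prod)}.Finite := by
  have hlen : ∀ l : List ι, RaisesBy l.length (l.map x).prod := fun l => by
    induction l with
    | nil => exact raisesBy_zero _
    | cons i l ih =>
      rw [List.map_cons, List.prod_cons, List.length_cons, add_comm]
      exact (hx.1 i).mul ih
  have hmem : ∀ l : List ι, ∀ i ∈ l, RaisesBy D (x i) → RaisesBy D (l.map x).prod := by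
    intro l i hi hD
    obtain ⟨s, t, rfl⟩ := List.append_of_mem hi
    rw [List.map_append, List.prod_append, List.map_cons, List.prod_cons]
    exact (hD.mul_right _).mul_left _
  have hfin := (hx.2 D).to_subtype
  refine ((List.finite_length_le {i | ¬ RaisesBy D (x i)} D).image
    (List.map Subtype.val)).subset fun l hl => ?_
  have h1 : ∀ i ∈ l, i ∈ {i | ¬ RaisesBy D (x i)} := fun i hi hD => hl ((hmem l i hi hD).smul _)
  refine ⟨l.attachWith (· ∈ {i | ¬ RaisesBy D (x i)}) h1, ?_, List.attachWith_map_subtype_val _⟩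
  rw [Set.mem_ofPred_eq, List.length_attachWith]
  by_contra hlt
  exact hl (((hlen l).mono (by omega)).smul _)

theorem Admissible.summable_prod {ι : Type*} {x : ι → Op X} (hx : Admissible x)
    (c : List ι → ℂ) : Summable fun l => c l • (l.map x).prod :=
  op_summable_of_finite (hx.finite_prod c)

end Raises

/-! ### Truncation of operators to finite matrices -/

section Trunc

variable {X : Type} [GradedAlphabet X]

/-- The words of degree at most `N`. -/
abbrev LowWord (X : Type) [GradedAlphabet X] (N : ℕ) : Type := {w : Word X // w.deg ≤ N}

instance (N : ℕ) : Fintype (LowWord X N) := (Word.finite_deg_le N).fintype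

/-- The matrix of an operator on the words of degree at most `N`. -/
def truncMatrix (N : ℕ) (T : Op X) : Matrix (LowWord X N) (LowWord X N) ℂ :=
  Matrix.of fun u w => T u.1 w.1

theorem truncMatrix_mul (N : ℕ) (S T : Op X) :
    truncMatrix N (S * T) = truncMatrix N S * truncMatrix N T := by
  ext u w
  simp only [truncMatrix, Matrix.of_apply, IncidenceAlgebra.mul_apply, Matrix.mul_apply]
  have hinj : Set.InjOn (Subtype.val : LowWord X N → Word X)
      (Finset.univ.filter fun v : LowWord X N => v.1 ∈ Finset.Icc u.1 w.1) :=
    Subtype.val_injective.injOn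
  rw [← Finset.sum_filter_of_ne (p := fun v : LowWord X N => v.1 ∈ Finset.Icc u.1 w.1)]
  · refine (Finset.sum_of_injOn Subtype.val hinj ?_ ?_ fun _ _ => rfl).symm
    · intro v hv
      simpa using hv
    · intro v hv hv'
      exact (hv' ⟨⟨v, (Word.le_def.1 (Finset.mem_Icc.1 hv).1).trans u.2⟩,
        Finset.mem_coe.2 (Finset.mem_filter.2 ⟨Finset.mem_univ _, hv⟩), rfl⟩).elim
  · intro v _ hv
    exact Finset.mem_Icc.2 ⟨IncidenceAlgebra.le_of_ne_zero (left_ne_zero_of_mul hv),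
      IncidenceAlgebra.le_of_ne_zero (right_ne_zero_of_mul hv)⟩

/-- Truncation of operators to the words of degree at most `N`. It is multiplicative because
operators do not lower the degree. -/
def trunc (N : ℕ) : Op X →ₐ[ℂ] Matrix (LowWord X N) (LowWord X N) ℂ :=
  AlgHom.ofLinearMap
    { toFun := truncMatrix N
      map_add' := fun _ _ => by ext; simp [truncMatrix]
      map_smul' := fun _ _ => by ext; simp [truncMatrix] }
    (by
      ext u w
      simp [truncMatrix, Matrix.one_apply, Subtype.ext_iff])
    (truncMatrix_mul N)

@[simp]
theorem trunc_apply (N : ℕ) (T : Op X) (u w : LowWord X N) : trunc N T u w = T u.1 w.1 := rfl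

theorem op_ext_trunc {S T : Op X} (h : ∀ N, trunc N S = trunc N T) : S = T := by
  ext u w huw
  exact congr_fun (congr_fun (h u.deg) ⟨u, le_rfl⟩) ⟨w, Word.le_def.1 huw⟩

theorem continuous_trunc (N : ℕ) : Continuous (trunc N : Op X → Matrix _ _ ℂ) :=
  continuous_matrix fun u w => continuous_op_apply u.1 w.1

theorem op_summable_iff_trunc {ι : Type*} {f : ι → Op X} :
    Summable f ↔ ∀ N, Summable fun i => trunc N (f i) := by
  refine ⟨fun h N => h.map (trunc N) (continuous_trunc N), fun h => op_summable_iff.2 fun u w => ?_⟩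
  by_cases huw : u ≤ w
  · exact Pi.summable.1 (Pi.summable.1 (h u.deg) ⟨u, le_rfl⟩) ⟨w, Word.le_def.1 huw⟩
  · simp [IncidenceAlgebra.apply_eq_zero_of_not_le huw]

theorem trunc_tsum {ι : Type*} {f : ι → Op X} (hf : Summable f) (N : ℕ) :
    trunc N (∑' i, f i) = ∑' i, trunc N (f i) :=
  hf.map_tsum (trunc N) (continuous_trunc N)

theorem RaisesBy.trunc_eq_zero {n N : ℕ} {x : Op X} (h : RaisesBy n x) (hn : N < n) :
    trunc N x = 0 := by
  ext u w
  by_contra h0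
  have := h u.1 w.1 h0
  have := u.2
  omega

theorem trunc_adPow (N : ℕ) (x y : Op X) (j : ℕ) :
    trunc N (adPow x j y) = adPow (trunc N x) j (trunc N y) := by
  induction j with
  | zero => rfl
  | succ j ih =>
    rw [adPow, adPow, Function.iterate_succ_apply', Function.iterate_succ_apply', ← adPow,
      ← adPow, Ring.lie_def, Ring.lie_def, map_sub, map_mul, map_mul, ih]

end Trunc

/-! ### The exponential of an operator -/

section Exp

variable {X : Type} [GradedAlphabet X]

theorem matrix_summable_exp {S : Type*} [Fintype S] [DecidableEq S] (A : Matrix S S ℂ) :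
    Summable fun n : ℕ => ((n.factorial : ℂ)⁻¹) • A ^ n :=
  open scoped Matrix.Norms.Operator in NormedSpace.expSeries_summable' (𝕂 := ℂ) A

theorem op_summable_exp (x : Op X) : Summable fun n : ℕ => ((n.factorial : ℂ)⁻¹) • x ^ n :=
  op_summable_iff_trunc.2 fun N => by
    simpa only [map_smul, map_pow] using matrix_summable_exp (trunc N x)

theorem trunc_opExp (N : ℕ) (x : Op X) : trunc N (opExp x) = NormedSpace.exp (trunc N x) := by
  rw [opExp, trunc_tsum (op_summable_exp x), NormedSpace.exp_eq_tsum ℂ]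
  simp only [map_smul, map_pow]

theorem opExp_add_of_commute {x y : Op X} (h : Commute x y) :
    opExp (x + y) = opExp x * opExp y :=
  op_ext_trunc fun N => by
    rw [map_mul, trunc_opExp, trunc_opExp, trunc_opExp, map_add,
      Matrix.exp_add_of_commute _ _ (h.map (trunc N))]

theorem opExp_zero : opExp (0 : Op X) = 1 :=
  op_ext_trunc fun N => by rw [trunc_opExp, map_zero, map_one, NormedSpace.exp_zero]

theorem opExp_add_smul (a b : ℂ) (x : Op X) :
    opExp ((a + b) • x) = opExp (a • x) * opExp (b • x) := by
  rw [add_smul, opExp_add_of_commute (((Commute.refl x).smul_left a).smul_right b)]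

theorem opExp_mul_opExp_neg (a : ℂ) (x : Op X) : opExp (a • x) * opExp ((-a) • x) = 1 := by
  rw [← opExp_add_smul, add_neg_cancel, zero_smul, opExp_zero]

theorem opExp_neg_mul_opExp (a : ℂ) (x : Op X) : opExp ((-a) • x) * opExp (a • x) = 1 := by
  rw [← opExp_add_smul, neg_add_cancel, zero_smul, opExp_zero]

theorem isUnit_opExp_smul (a : ℂ) (x : Op X) : IsUnit (opExp (a • x)) :=
  ⟨⟨_, _, opExp_mul_opExp_neg a x, opExp_neg_mul_opExp a x⟩, rfl⟩

theorem Commute.opExp_smul_left {x y : Op X} (h : Commute x y) (a : ℂ) :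
    Commute (opExp (a • x)) y :=
  Commute.tsum_left _ fun _ => (((h.smul_left a).pow_left _).smul_left _)

/-- A unipotent operator is invertible. -/
theorem isUnit_one_sub_of_raisesBy {x : Op X} (hx : RaisesBy 1 x) : IsUnit (1 - x) := by
  have hs : Summable fun n : ℕ => x ^ n := op_summable_of_finite fun D =>
    (Set.finite_lt_nat D).subset fun n hn => by
      by_contra hlt
      exact hn ((hx.pow n).mono (not_lt.1 hlt))
  have ht : ∀ N, trunc N (∑' n, x ^ n) = ∑ n ∈ Finset.range (N + 1), trunc N x ^ n := fun N => by
    rw [trunc_tsum hs, tsum_eq_sum (s := Finset.range (N + 1))]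
    · simp only [map_pow]
    · intro n hn
      exact (hx.pow n).trunc_eq_zero (by simpa using hn)
  have hz : ∀ N, trunc N x ^ (N + 1) = 0 := fun N => by
    rw [← map_pow]
    exact (hx.pow (N + 1)).trunc_eq_zero (Nat.lt_succ_self N)
  refine ⟨⟨1 - x, ∑' n, x ^ n, op_ext_trunc fun N => ?_, op_ext_trunc fun N => ?_⟩, rfl⟩
  · rw [map_mul, ht, map_sub, map_one, mul_neg_geom_sum, hz, sub_zero]
  · rw [map_mul, ht, map_sub, map_one, geom_sum_mul_neg, hz, sub_zero]

end Exp

/-! ### Regularised integrals -/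

section RegInt

theorem exp_isBigO_exp_of_le {a b : ℝ} (h : a ≤ b) :
    (fun t : ℝ => Real.exp (a * t)) =O[atTop] fun t : ℝ => Real.exp (b * t) := by
  refine IsBigO.of_bound 1 ?_
  filter_upwards [eventually_ge_atTop 0] with t ht
  rw [one_mul, Real.norm_eq_abs, Real.norm_eq_abs, Real.abs_exp, Real.abs_exp]
  exact Real.exp_le_exp.2 (mul_le_mul_of_nonneg_right h ht)

/-- Polynomials grow subexponentially along vertical half-lines. -/
theorem polynomial_vertical_isBigO_exp (P : ℂ[X]) (τ : ℂ) {ε : ℝ} (hε : 0 < ε) :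
    (fun t : ℝ => P.eval (τ + t * I)) =O[atTop] fun t : ℝ => Real.exp (ε * t) := by
  have hconst : ∀ (a : ℂ) (δ : ℝ), 0 < δ →
      (fun _ : ℝ => a) =O[atTop] fun t : ℝ => Real.exp (δ * t) := fun a δ hδ => by
    have h := exp_isBigO_exp_of_le hδ.le
    simp only [zero_mul, Real.exp_zero] at h
    exact (isBigO_const_const a one_ne_zero atTop).trans h
  induction P using Polynomial.induction_on generalizing ε with
  | C a => simpa using hconst a ε hε
  | add p q hp hq => simpa using (hp hε).add (hq hε)
  | monomial n a ih =>
    have hlin : (fun t : ℝ => τ + t * I) =O[atTop] fun t : ℝ => Real.exp (ε / 2 * t) := by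
      refine (hconst τ _ (half_pos hε)).add ?_
      have h := (isLittleO_pow_exp_pos_mul_atTop 1 (half_pos hε)).isBigO
      refine IsBigO.trans (IsBigO.of_bound 1 (Eventually.of_forall fun t => ?_)) h
      simp
    refine ((ih (half_pos hε)).mul hlin).congr (fun t => ?_) fun t => ?_
    · simp only [eval_mul, eval_C, eval_pow, eval_X]
      ring
    · rw [← Real.exp_add]
      ring_nf

/-- `F` is continuous along vertical lines of the upper half-plane, and exponentially close to the
polynomial `P` at the cusp. Nothing more is needed for regularised integration along vertical
half-lines. -/
structure CuspAsymp (F : ℂ → ℂ) (P : ℂ[X]) : Prop where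
  cont : ∀ τ : ℂ, 0 < τ.im → ContinuousAt (fun t : ℝ => F (τ + t * I)) 0
  asymp : HasPolyAsymp F P

theorem HasPolyAsymp.exists_lt {F : ℂ → ℂ} {P : ℂ[X]} (h : HasPolyAsymp F P) :
    ∃ c₀ : ℝ, 0 < c₀ ∧ ∀ c ≤ c₀, ∀ τ : ℂ, 0 < τ.im →
      (fun t : ℝ => F (τ + t * I) - P.eval (τ + t * I)) =O[atTop]
        fun t : ℝ => Real.exp (-c * t) := by
  obtain ⟨c₀, hc₀, hF⟩ := h
  exact ⟨c₀, hc₀, fun c hc τ hτ => (hF τ hτ).trans (exp_isBigO_exp_of_le (by linarith))⟩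

theorem hasPolyAsymp_eval (P : ℂ[X]) : HasPolyAsymp (fun z => P.eval z) P :=
  ⟨1, one_pos, fun τ _ => by simpa using isBigO_zero _ _⟩

theorem HasPolyAsymp.add {F G : ℂ → ℂ} {P Q : ℂ[X]} (hF : HasPolyAsymp F P)
    (hG : HasPolyAsymp G Q) : HasPolyAsymp (fun z => F z + G z) (P + Q) := by
  obtain ⟨c, hc, h⟩ := hF.exists_lt
  obtain ⟨d, hd, h'⟩ := hG.exists_lt
  refine ⟨min c d, lt_min hc hd, fun τ hτ => ?_⟩
  refine ((h _ (min_le_left _ _) τ hτ).add (h' _ (min_le_right _ _) τ hτ)).congr_left fun t => ?_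
  rw [eval_add]
  ring

theorem HasPolyAsymp.mul {F G : ℂ → ℂ} {P Q : ℂ[X]} (hF : HasPolyAsymp F P)
    (hG : HasPolyAsymp G Q) : HasPolyAsymp (fun z => F z * G z) (P * Q) := by
  obtain ⟨c, hc, h⟩ := hF.exists_lt
  obtain ⟨d, hd, h'⟩ := hG.exists_lt
  -- half of the decay rate is sacrificed to the polynomial growth of the other factor
  set e := min c d with he
  have he0 : 0 < e := lt_min hc hd
  refine ⟨e / 2, half_pos he0, fun τ hτ => ?_⟩
  have h1 := h e (min_le_left _ _) τ hτ
  have h2 := h' e (min_le_right _ _) τ hτ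
  have hG' : (fun t : ℝ => G (τ + t * I)) =O[atTop] fun t : ℝ => Real.exp (e / 2 * t) := by
    refine ((h2.trans (exp_isBigO_exp_of_le (b := e / 2) (by linarith))).add
      (polynomial_vertical_isBigO_exp Q τ (half_pos he0))).congr_left fun t => ?_
    ring
  have hexp : ∀ t : ℝ, Real.exp (-e * t) * Real.exp (e / 2 * t) = Real.exp (-(e / 2) * t) :=
    fun t => by
      rw [← Real.exp_add]
      ring_nf
  refine (((h1.mul hG').congr_right hexp).add ((h2.mul
    (polynomial_vertical_isBigO_exp P τ (half_pos he0))).congr_right hexp)).congr_left fun t => ?_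
  rw [eval_mul]
  ring

theorem HasPolyAsymp.unique {F : ℂ → ℂ} {P Q : ℂ[X]} (hP : HasPolyAsymp F P)
    (hQ : HasPolyAsymp F Q) : P = Q := by
  obtain ⟨c, hc, h⟩ := hP.exists_lt
  obtain ⟨d, hd, h'⟩ := hQ.exists_lt
  set e := min c d with he
  have he0 : 0 < e := lt_min hc hd
  have hlim : Tendsto (fun t : ℝ => (Q - P).eval (I + t * I)) atTop (nhds 0) := by
    have h1 : (fun t : ℝ => (Q - P).eval (I + t * I)) =O[atTop] fun t : ℝ => Real.exp (-e * t) := by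
      refine ((h e (min_le_left _ _) I (by simp)).sub
        (h' e (min_le_right _ _) I (by simp))).congr_left fun t => ?_
      rw [eval_sub]
      ring
    refine h1.trans_tendsto (Real.tendsto_exp_atBot.comp ?_)
    exact tendsto_id.const_mul_atTop_of_neg (neg_lt_zero.2 he0)
  by_contra hne
  have hsub : Q - P ≠ 0 := fun h0 => hne (sub_eq_zero.1 h0).symm
  rcases le_or_gt (Q - P).degree 0 with hdeg | hdeg
  · rw [eq_C_of_degree_le_zero hdeg] at hlim hsub
    simp only [eval_C] at hlim
    exact hsub (by rw [← tendsto_nhds_unique hlim tendsto_const_nhds, C_0])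
  · have hz : Tendsto (fun t : ℝ => ‖I + t * I‖) atTop atTop := by
      refine tendsto_atTop_mono' _ ?_ tendsto_id
      filter_upwards [eventually_ge_atTop 0] with t ht
      have : I + t * I = ((1 + t : ℝ) : ℂ) * I := by push_cast; ring
      rw [this, norm_mul, norm_I, mul_one, Complex.norm_real, Real.norm_eq_abs]
      exact le_trans (by simp) (le_abs_self _)
    exact not_tendsto_nhds_of_tendsto_atTop ((Q - P).tendsto_norm_atTop hdeg hz) 0
      (by simpa using hlim.norm)

theorem regPoly_eq {F : ℂ → ℂ} {P : ℂ[X]} (h : HasPolyAsymp F P) : regPoly F = P := by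
  have hex : ∃ P, HasPolyAsymp F P := ⟨P, h⟩
  rw [regPoly, dif_pos hex]
  exact hex.choose_spec.unique h

namespace CuspAsymp

variable {F G : ℂ → ℂ} {P Q : ℂ[X]}

theorem add (hF : CuspAsymp F P) (hG : CuspAsymp G Q) : CuspAsymp (fun z => F z + G z) (P + Q) :=
  ⟨fun τ hτ => (hF.cont τ hτ).add (hG.cont τ hτ), hF.asymp.add hG.asymp⟩

theorem mul (hF : CuspAsymp F P) (hG : CuspAsymp G Q) : CuspAsymp (fun z => F z * G z) (P * Q) :=
  ⟨fun τ hτ => (hF.cont τ hτ).mul (hG.cont τ hτ), hF.asymp.mul hG.asymp⟩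

theorem eval (P : ℂ[X]) : CuspAsymp (fun z => P.eval z) P :=
  ⟨fun τ _ => by
    have h : Continuous fun t : ℝ => P.eval (τ + t * I) :=
      P.continuous.comp (by fun_prop)
    exact h.continuousAt, hasPolyAsymp_eval P⟩

theorem const (a : ℂ) : CuspAsymp (fun _ => a) (C a) := by
  simpa using eval (C a)

theorem sum {ι : Type*} {s : Finset ι} {F : ι → ℂ → ℂ} {P : ι → ℂ[X]}
    (h : ∀ i ∈ s, CuspAsymp (F i) (P i)) :
    CuspAsymp (fun z => ∑ i ∈ s, F i z) (∑ i ∈ s, P i) := by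
  classical
  induction s using Finset.induction_on with
  | empty => simpa using const 0
  | insert a s ha ih =>
    simp only [Finset.sum_insert ha]
    exact (h a (by simp)).add (ih fun i hi => h i (by simp [hi]))

theorem continuousOn (hF : CuspAsymp F P) {τ : ℂ} (hτ : 0 < τ.im) :
    ContinuousOn (fun t : ℝ => F (τ + t * I)) (Set.Ici 0) := by
  intro t ht
  have him : 0 < (τ + t * I).im := by
    have : (0 : ℝ) ≤ t := ht
    simp
    linarith
  have h := hF.cont _ him
  have h2 : ContinuousAt (fun s : ℝ => F (τ + t * I + (s - t : ℝ) * I)) t :=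
    ContinuousAt.comp (f := fun s : ℝ => s - t) (g := fun s : ℝ => F (τ + t * I + s * I))
      (by simpa using h) (by fun_prop)
  refine (h2.congr (Eventually.of_forall fun s => ?_)).continuousWithinAt
  simp only
  congr 1
  push_cast
  ring

end CuspAsymp

/-- The primitive of `-P` that vanishes at `0`. -/
def regPrim (P : ℂ[X]) : ℂ[X] := -P.sum fun n a => C (a / (n + 1)) * X ^ (n + 1)

theorem eval_regPrim (P : ℂ[X]) (z : ℂ) :
    (regPrim P).eval z = -P.sum fun n a => a * z ^ (n + 1) / (n + 1) := by
  rw [regPrim, eval_neg, Polynomial.sum, Polynomial.sum, eval_finsetSum]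
  congr 1
  refine Finset.sum_congr rfl fun n _ => ?_
  simp only [eval_mul, eval_C, eval_pow, eval_X]
  ring

theorem eval_zero_regPrim (P : ℂ[X]) : (regPrim P).eval 0 = 0 := by
  rw [eval_regPrim, Polynomial.sum]
  simp

theorem derivative_regPrim (P : ℂ[X]) : derivative (regPrim P) = -P := by
  rw [regPrim, derivative_neg, Polynomial.sum, derivative_sum]
  conv_rhs => rw [P.as_sum_support_C_mul_X_pow]
  congr 1
  refine Finset.sum_congr rfl fun n _ => ?_
  have : (n : ℂ) + 1 ≠ 0 := Nat.cast_add_one_ne_zero n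
  rw [derivative_C_mul, derivative_X_pow, ← mul_assoc, ← C_mul]
  simp only [Nat.cast_add, Nat.cast_one, Nat.add_sub_cancel]
  rw [div_mul_cancel₀ _ this]

namespace CuspAsymp

variable {F : ℂ → ℂ} {P : ℂ[X]}

theorem integrableOn (hF : CuspAsymp F P) {τ : ℂ} (hτ : 0 < τ.im) :
    MeasureTheory.IntegrableOn (fun t : ℝ => F (τ + t * I) - P.eval (τ + t * I)) (Set.Ioi 0) := by
  obtain ⟨c, hc, h⟩ := hF.asymp
  have hcont := (hF.continuousOn hτ).sub ((CuspAsymp.eval P).continuousOn hτ)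
  refine integrableOn_Ici_iff_integrableOn_Ioi (by finiteness) |>.mp <|
    (hcont.locallyIntegrableOn measurableSet_Ici).integrableOn_of_isBigO_atTop
    (h τ hτ) ⟨Set.Ioi c, Ioi_mem_atTop c, exp_neg_integrableOn_Ioi c hc⟩

theorem regIntegrable (hF : CuspAsymp F P) : RegIntegrable F := by
  refine ⟨⟨P, hF.asymp⟩, fun τ hτ => ?_⟩
  rw [regPoly_eq hF.asymp]
  exact hF.integrableOn hτ

/-- The regularised integral along a vertical half-line is that of the decaying part, plus the
polynomial primitive. -/
theorem regInt_eq (hF : CuspAsymp F P) (τ : ℂ) (s : ℝ) :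
    regInt F (τ + s * I) =
      (∫ t in Set.Ioi s, (F (τ + t * I) - P.eval (τ + t * I))) * I
        + (regPrim P).eval (τ + s * I) := by
  rw [regInt, regPoly_eq hF.asymp, eval_regPrim, ← sub_eq_add_neg,
    MeasureTheory.integral_mul_const]
  congr 2
  rw [← MeasureTheory.integral_indicator measurableSet_Ioi,
    ← MeasureTheory.integral_indicator measurableSet_Ioi]
  refine Eq.trans ?_ (MeasureTheory.integral_add_right_eq_self (μ := MeasureTheory.volume)
    ((Set.Ioi s).indicator fun t : ℝ => F (τ + t * I) - P.eval (τ + t * I)) s)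
  congr 1
  ext t
  have h : τ + s * I + t * I = τ + ((t + s : ℝ) : ℂ) * I := by
    push_cast
    ring
  simp only [Set.indicator_apply, Set.mem_Ioi, lt_add_iff_pos_left, h]

theorem hasDerivAt_regInt (hF : CuspAsymp F P) {τ : ℂ} (hτ : 0 < τ.im) :
    HasDerivAt (fun t : ℝ => regInt F (τ + t * I)) (-(F τ * I)) 0 := by
  -- the half-line starts below `τ`, which makes `τ` an interior point of it
  set r := τ.im / 2 with hr
  have hr0 : 0 < r := half_pos hτ
  set σ : ℂ := τ - r * I with hσ
  have hσim : 0 < σ.im := by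
    simp [hσ]
    linarith
  set D : ℝ → ℂ := fun t => F (σ + t * I) - P.eval (σ + t * I) with hD
  have hint : MeasureTheory.IntegrableOn D (Set.Ioi 0) := hF.integrableOn hσim
  have hDc : ContinuousOn D (Set.Ici 0) :=
    (hF.continuousOn hσim).sub ((CuspAsymp.eval P).continuousOn hσim)
  have h1 : HasDerivAt (fun s : ℝ => ∫ t in (0 : ℝ)..s, D t) (D r) r := by
    have hnhds : Set.Ici (0 : ℝ) ∈ nhds r := Ici_mem_nhds hr0
    refine intervalIntegral.integral_hasDerivAt_right ?_ ?_ (hDc.continuousAt hnhds)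
    · rw [intervalIntegrable_iff, Set.uIoc_of_le hr0.le]
      exact hint.mono_set Set.Ioc_subset_Ioi_self
    · exact hDc.stronglyMeasurableAtFilter_nhdsWithin measurableSet_Ici r |>.filter_mono
        (by rw [nhdsWithin_eq_nhds.2 hnhds])
  have h2 : HasDerivAt (fun s : ℝ => (regPrim P).eval (σ + s * I))
      (-(P.eval (σ + r * I) * I)) r := by
    have h3 : HasDerivAt (fun s : ℝ => σ + s * I) I r := by
      simpa using ((hasDerivAt_id r).ofReal_comp.mul_const I).const_add σ
    have h4 := ((regPrim P).hasDerivAt (σ + r * I)).comp r h3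
    rw [derivative_regPrim] at h4
    exact HasDerivAt.congr_deriv h4 (by simp)
  have h5 : HasDerivAt (fun s : ℝ => regInt F (σ + s * I)) (-(F (σ + r * I) * I)) r := by
    have h6 := ((h1.const_sub (∫ t in Set.Ioi 0, D t)).mul_const I).add h2
    refine (h6.congr_of_eventuallyEq ?_).congr_deriv ?_
    · filter_upwards [Ici_mem_nhds hr0] with s hs
      rw [hF.regInt_eq σ s]
      simp only [Pi.add_apply]
      congr 2
      rw [eq_sub_iff_add_eq, add_comm]
      exact intervalIntegral.integral_interval_add_Ioi hint
        (hint.mono_set (Set.Ioi_subset_Ioi hs))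
    · simp only [hD]
      ring
  have hshift : σ + r * I = τ := by simp [hσ]
  rw [hshift] at h5
  have h7 := HasDerivAt.comp_add_const (f := fun s : ℝ => regInt F (σ + s * I)) 0 r
    (by simpa using h5)
  refine h7.congr_of_eventuallyEq (Eventually.of_forall fun t => ?_)
  simp only [hσ]
  congr 1
  push_cast
  ring

theorem regInt (hF : CuspAsymp F P) : CuspAsymp (regInt F) (regPrim P) := by
  refine ⟨fun τ hτ => (hF.hasDerivAt_regInt hτ).continuousAt, ?_⟩
  obtain ⟨c, hc, h⟩ := hF.asymp
  refine ⟨c, hc, fun τ hτ => ?_⟩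
  obtain ⟨A, hA⟩ := (h τ hτ).bound
  obtain ⟨t₀, ht₀⟩ := eventually_atTop.1 hA
  refine IsBigO.of_bound (A / c) ?_
  filter_upwards [eventually_ge_atTop t₀] with s hs
  rw [hF.regInt_eq τ s, add_sub_cancel_right, norm_mul, norm_I, mul_one, Real.norm_eq_abs,
    Real.abs_exp]
  calc _ ≤ ∫ t in Set.Ioi s, A * Real.exp (-c * t) := by
        refine MeasureTheory.norm_integral_le_of_norm_le
          ((exp_neg_integrableOn_Ioi s hc).const_mul A) ?_
        refine (MeasureTheory.ae_restrict_mem measurableSet_Ioi).mono fun t ht => ?_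
        simpa using ht₀ t (hs.trans (le_of_lt ht))
    _ = A / c * Real.exp (-c * s) := by
        rw [MeasureTheory.integral_const_mul, integral_exp_mul_Ioi (neg_lt_zero.2 hc)]
        field_simp

end CuspAsymp

end RegInt

/-! ### Modular forms at the cusp -/

section Modular

open UpperHalfPlane hiding I
open EisensteinSeries ModularFormClass

/-- A modular form of level one is exponentially close to its value at the cusp. -/
theorem cuspAsymp_modularForm {F : Type*} [FunLike F ℍ ℂ] {k : ℤ} [ModularFormClass F 𝒮ℒ k]
    (f : F) : CuspAsymp (fun τ => f (ofComplex τ)) (C (valueAtInfty f)) := by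
  refine ⟨fun τ hτ => ?_, ?_⟩
  · have hd := UpperHalfPlane.mdifferentiable_iff.1 (ModularFormClass.holo f)
    have hc : ContinuousAt (f ∘ ofComplex) τ :=
      hd.continuousOn.continuousAt (isOpen_upperHalfPlaneSet.mem_nhds hτ)
    exact ContinuousAt.comp (f := fun t : ℝ => τ + t * I) (g := f ∘ ofComplex) (by simpa using hc)
      (by fun_prop)
  · obtain ⟨c, hc, h⟩ := ModularFormClass.exp_decay_sub_atImInfty' f
    refine ⟨c, hc, fun τ hτ => ?_⟩
    have him : ∀ t : ℝ, 0 ≤ t → 0 < (τ + t * I).im := fun t ht => by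
      simp
      linarith
    have hlim : Tendsto (fun t : ℝ => ofComplex (τ + t * I)) atTop atImInfty := by
      rw [atImInfty, tendsto_comap_iff]
      refine (tendsto_atTop_add_const_left _ τ.im tendsto_id).congr' ?_
      filter_upwards [eventually_ge_atTop 0] with t ht
      rw [Function.comp_apply, ofComplex_apply_of_im_pos (him t ht)]
      simp [UpperHalfPlane.im]
    have h1 := h.comp_tendsto hlim
    refine (h1.congr' ?_ ?_ : _ =O[atTop] fun t : ℝ => Real.exp (-c * τ.im) *
      Real.exp (-c * t)).trans (isBigO_const_mul_self _ _ _)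
    · exact Eventually.of_forall fun t => by simp
    · filter_upwards [eventually_ge_atTop 0] with t ht
      rw [Function.comp_apply, ofComplex_apply_of_im_pos (him t ht), ← Real.exp_add]
      simp [UpperHalfPlane.im]
      ring

theorem modularForm_add_one {F : Type*} [FunLike F ℍ ℂ] {k : ℤ} [ModularFormClass F 𝒮ℒ k]
    (f : F) (τ : ℂ) : f (ofComplex (τ + 1)) = f (ofComplex τ) := by
  have := SlashInvariantFormClass.periodic_comp_ofComplex (h := 1) f
    one_mem_strictPeriods_SL τ
  simpa using this

theorem cuspAsymp_cuspForm {k : ℤ} (Δ : CuspForm 𝒮ℒ k) :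
    CuspAsymp (fun τ => Δ (ofComplex τ)) 0 := by
  have h := cuspAsymp_modularForm Δ
  rwa [(CuspFormClass.zero_at_infty Δ).valueAtInfty_eq_zero, C_0] at h

theorem summable_Gk_term {k : ℕ} (hk : 3 ≤ k) {τ : ℂ} (hτ : 0 < τ.im) :
    Summable fun p : {p : ℤ × ℤ // p ≠ 0} => 1 / ((p.1.1 : ℂ) * τ + (p.1.2 : ℂ)) ^ k := by
  have h := (summable_prod_eisSummand hk ⟨τ, hτ⟩).subtype {p : ℤ × ℤ | p ≠ 0}
  refine h.congr fun p => ?_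
  simp [eisSummand]

theorem Gk_eq {k : ℕ} (hk : 3 ≤ k) {τ : ℂ} (hτ : 0 < τ.im) :
    Gk k τ = 2 * riemannZeta k * ModularForm.E hk (ofComplex τ) := by
  have h1 := tsum_eisSummand_eq_riemannZeta_mul_eisensteinSeries hk ⟨τ, hτ⟩
  rw [ofComplex_apply_of_im_pos hτ,
    show ModularForm.E hk ⟨τ, hτ⟩ = (1 / 2 : ℂ) • eisensteinSeriesSIF (N := 1) 0 k ⟨τ, hτ⟩ from rfl,
    eisensteinSeriesSIF_apply 0 k, smul_eq_mul]
  rw [show ∀ a b : ℂ, 2 * a * (1 / 2 * b) = a * b from fun a b => by ring, ← h1,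
    ← (finTwoArrowEquiv ℤ).symm.tsum_eq, finTwoArrowEquiv_symm_apply, Gk]
  -- the summand at `(0, 0)` is `1 / 0 ^ k = 0`
  refine Eq.trans ?_ (tsum_subtype_eq_of_support_subset
    (f := fun p : ℤ × ℤ => eisSummand k ![p.1, p.2] ⟨τ, hτ⟩) (s := {p | p ≠ 0}) ?_)
  · refine tsum_congr fun p => ?_
    simp [eisSummand]
  · rintro p hp rfl
    refine hp ?_
    have : k ≠ 0 := by omega
    simp [eisSummand, this]

theorem two_mul_riemannZeta_even {k : ℕ} (hk : 4 ≤ k) (hk2 : Even k) :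
    2 * riemannZeta k
      = -((2 * Real.pi * I) ^ k * (bernoulli k : ℚ) / (k.factorial : ℂ)) := by
  obtain ⟨m, rfl⟩ := hk2
  rw [← two_mul, Nat.cast_mul, Nat.cast_two, riemannZeta_two_mul_nat (by omega)]
  obtain ⟨n, rfl⟩ : ∃ n, m = n + 1 := ⟨m - 1, by omega⟩
  rw [show 2 * (n + 1) - 1 = 2 * n + 1 by omega, mul_pow, mul_pow, pow_mul I, I_sq]
  field_simp
  ring

theorem valueAtInfty_E {k : ℕ} (hk : 3 ≤ k) (hk2 : Even k) :
    valueAtInfty (ModularForm.E hk) = 1 := by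
  rw [← EisensteinSeries.E_qExpansion_coeff_zero hk hk2]
  exact (qExpansion_coeff_zero one_pos
    (ModularFormClass.analyticAt_cuspFunction_zero (ModularForm.E hk) one_pos
      one_mem_strictPeriods_SL)
    (SlashInvariantFormClass.periodic_comp_ofComplex (ModularForm.E hk)
      one_mem_strictPeriods_SL)).symm

theorem CuspAsymp.congr {F G : ℂ → ℂ} {P : ℂ[X]} (hF : CuspAsymp F P)
    (h : ∀ τ : ℂ, 0 < τ.im → F τ = G τ) : CuspAsymp G P := by
  refine ⟨fun τ hτ => (hF.cont τ hτ).congr ?_, ?_⟩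
  · have hc : ContinuousAt (fun t : ℝ => (τ + t * I).im) 0 := by fun_prop
    filter_upwards [hc.eventually (lt_mem_nhds (by simpa using hτ))] with t ht
    exact h _ ht
  · obtain ⟨c, hc, hO⟩ := hF.asymp
    refine ⟨c, hc, fun τ hτ => (hO τ hτ).congr' ?_ EventuallyEq.rfl⟩
    filter_upwards [eventually_ge_atTop 0] with t ht
    rw [h _ (by simp; linarith)]

theorem cuspAsymp_Gk {k : ℕ} (hk : 4 ≤ k) (hk2 : Even k) :
    CuspAsymp (Gk k)
      (C (-((2 * Real.pi * I) ^ k * (bernoulli k : ℚ) / (k.factorial : ℂ)))) := by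
  have hk3 : 3 ≤ k := by omega
  have h := (CuspAsymp.const (2 * riemannZeta k)).mul (cuspAsymp_modularForm (ModularForm.E hk3))
  rw [valueAtInfty_E hk3 hk2, C_1, mul_one, two_mul_riemannZeta_even hk hk2] at h
  exact h.congr fun τ hτ => by rw [Gk_eq hk3 hτ, two_mul_riemannZeta_even hk hk2]

theorem Gk_add_one (k : ℕ) (τ : ℂ) : Gk k (τ + 1) = Gk k τ := by
  let e : {p : ℤ × ℤ // p ≠ 0} ≃ {p : ℤ × ℤ // p ≠ 0} :=
    { toFun := fun p => ⟨(p.1.1, p.1.1 + p.1.2), fun h => p.2 (by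
        simp only [Prod.ext_iff, Prod.fst_zero, Prod.snd_zero] at h ⊢
        omega)⟩
      invFun := fun p => ⟨(p.1.1, p.1.2 - p.1.1), fun h => p.2 (by
        simp only [Prod.ext_iff, Prod.fst_zero, Prod.snd_zero] at h ⊢
        omega)⟩
      left_inv := fun p => by simp
      right_inv := fun p => by simp }
  refine (tsum_congr fun p => ?_).trans (e.tsum_eq _)
  simp only [e, Equiv.coe_fn_mk]
  push_cast
  ring_nf

end Modular

/-! ### Entrywise differentiation of matrices -/

section MatrixDeriv

variable {S : Type}

/-- Entrywise differentiability of a matrix-valued function. -/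
def MatrixHasDerivAt {𝕜 : Type} [NontriviallyNormedField 𝕜] [NormedAlgebra 𝕜 ℂ]
    (F : 𝕜 → Matrix S S ℂ) (F' : Matrix S S ℂ) (t : 𝕜) : Prop :=
  ∀ u w, HasDerivAt (fun s => F s u w) (F' u w) t

namespace MatrixHasDerivAt

variable {𝕜 : Type} [NontriviallyNormedField 𝕜] [NormedAlgebra 𝕜 ℂ]
  {F G : 𝕜 → Matrix S S ℂ} {F' G' : Matrix S S ℂ} {t : 𝕜}

theorem const (M : Matrix S S ℂ) : MatrixHasDerivAt (fun _ => M) 0 t :=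
  fun _ _ => hasDerivAt_const _ _

theorem add (hF : MatrixHasDerivAt F F' t) (hG : MatrixHasDerivAt G G' t) :
    MatrixHasDerivAt (fun s => F s + G s) (F' + G') t :=
  fun u w => (hF u w).add (hG u w)

theorem sub (hF : MatrixHasDerivAt F F' t) (hG : MatrixHasDerivAt G G' t) :
    MatrixHasDerivAt (fun s => F s - G s) (F' - G') t :=
  fun u w => (hF u w).sub (hG u w)

theorem sum {ι : Type*} {s : Finset ι} {F : ι → 𝕜 → Matrix S S ℂ} {F' : ι → Matrix S S ℂ}
    (h : ∀ i ∈ s, MatrixHasDerivAt (F i) (F' i) t) :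
    MatrixHasDerivAt (fun x => ∑ i ∈ s, F i x) (∑ i ∈ s, F' i) t := fun u w => by
  simp only [Matrix.sum_apply]
  exact HasDerivAt.fun_sum fun i hi => h i hi u w

theorem mul [Fintype S] (hF : MatrixHasDerivAt F F' t) (hG : MatrixHasDerivAt G G' t) :
    MatrixHasDerivAt (fun s => F s * G s) (F' * G t + F t * G') t := fun u w => by
  simp only [Matrix.mul_apply, Matrix.add_apply, ← Finset.sum_add_distrib]
  exact HasDerivAt.fun_sum fun v _ => (hF u v).mul (hG v w)

theorem congr_deriv (hF : MatrixHasDerivAt F F' t) (h : F' = G') : MatrixHasDerivAt F G' t :=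
  h ▸ hF

end MatrixHasDerivAt

variable [Fintype S] [DecidableEq S]

open scoped Matrix.Norms.Operator in
theorem matrixHasDerivAt_exp_smul (A : Matrix S S ℂ) (c z : ℂ) :
    MatrixHasDerivAt (fun s : ℂ => NormedSpace.exp ((c * s) • A))
      (c • (NormedSpace.exp ((c * z) • A) * A)) z := fun u w => by
  have h := hasDerivAt_exp_smul_const (𝕂 := ℂ) (c • A) z
  have h2 := (Matrix.entryLinearMap ℂ ℂ u w).toContinuousLinearMap.hasFDerivAt.comp_hasDerivAt z h
  simp only [smul_smul, mul_comm _ c, mul_smul_comm] at h2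
  exact h2

theorem matrix_exp_mul_exp_neg (A : Matrix S S ℂ) (c : ℂ) :
    NormedSpace.exp (c • A) * NormedSpace.exp ((-c) • A) = 1 := by
  rw [← Matrix.exp_add_of_commute _ _ (((Commute.refl A).smul_left c).smul_right (-c)),
    ← add_smul, add_neg_cancel, zero_smul, NormedSpace.exp_zero]

theorem matrix_exp_neg_mul_exp (A : Matrix S S ℂ) (c : ℂ) :
    NormedSpace.exp ((-c) • A) * NormedSpace.exp (c • A) = 1 := by
  simpa using matrix_exp_mul_exp_neg A (-c)

theorem matrix_exp_add_smul (A : Matrix S S ℂ) (c d : ℂ) :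
    NormedSpace.exp ((c + d) • A) = NormedSpace.exp (c • A) * NormedSpace.exp (d • A) := by
  rw [← Matrix.exp_add_of_commute _ _ (((Commute.refl A).smul_left c).smul_right d), add_smul]

theorem adPow_succ {R : Type} [Ring R] (x y : R) (j : ℕ) :
    adPow x (j + 1) y = x * adPow x j y - adPow x j y * x := by
  rw [adPow, Function.iterate_succ_apply', ← adPow, Ring.lie_def]

/-- Conjugation by `exp (s E)` is the exponential of `ad E`, which is a finite sum on matrices
annihilated by a power of `ad E`. -/
theorem exp_conj_eq_sum_adPow {E M : Matrix S S ℂ} {m : ℕ} (h : adPow E m M = 0) (s : ℂ) :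
    NormedSpace.exp ((-s) • E) * M * NormedSpace.exp (s • E) =
      ∑ j ∈ Finset.range m, ((-s) ^ j / (j.factorial : ℂ)) • adPow E j M := by
  set p : ℂ → Matrix S S ℂ :=
    fun s => ∑ j ∈ Finset.range m, ((-s) ^ j / (j.factorial : ℂ)) • adPow E j M with hp
  have hp' : ∀ s, MatrixHasDerivAt p (-(E * p s - p s * E)) s := fun s => by
    have h1 : ∀ j ∈ Finset.range m, MatrixHasDerivAt
        (fun s : ℂ => ((-s) ^ j / (j.factorial : ℂ)) • adPow E j M)
        ((-(j * (-s) ^ (j - 1) / (j.factorial : ℂ))) • adPow E j M) s := fun j _ u w => by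
      have h2 := (((hasDerivAt_id s).neg.pow j).div_const (j.factorial : ℂ)).mul_const
        (adPow E j M u w)
      refine HasDerivAt.congr_deriv h2 ?_
      simp [neg_div]
    refine (MatrixHasDerivAt.sum h1).congr_deriv ?_
    simp only [hp, Finset.mul_sum, Finset.sum_mul, mul_smul_comm, smul_mul_assoc,
      ← Finset.sum_sub_distrib, ← smul_sub, ← adPow_succ, ← Finset.sum_neg_distrib]
    -- the sums agree up to a shift of the index; the extra term is killed by `h`
    rcases m with _ | m
    · simp
    rw [Finset.sum_range_succ', Finset.sum_range_succ _ m, h, smul_zero, neg_zero, add_zero]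
    simp only [Nat.cast_zero, zero_mul, zero_div, neg_zero, zero_smul, add_zero]
    refine Finset.sum_congr rfl fun j _ => ?_
    rw [neg_smul, Nat.add_sub_cancel, Nat.factorial_succ]
    congr 2
    have h3 : (j : ℂ) + 1 ≠ 0 := Nat.cast_add_one_ne_zero j
    have h4 : (j.factorial : ℂ) ≠ 0 := Nat.cast_ne_zero.2 j.factorial_ne_zero
    push_cast
    field_simp
  have hf : ∀ s, MatrixHasDerivAt
      (fun s : ℂ => NormedSpace.exp ((1 * s) • E) * p s * NormedSpace.exp ((-1 * s) • E)) 0 s :=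
    fun s => by
      refine (((matrixHasDerivAt_exp_smul E 1 s).mul (hp' s)).mul
        (matrixHasDerivAt_exp_smul E (-1) s)).congr_deriv ?_
      have hc : NormedSpace.exp ((-1 * s) • E) * E = E * NormedSpace.exp ((-1 * s) • E) :=
        (((Commute.refl E).smul_left (-1 * s)).exp_left).eq
      rw [one_smul, hc, neg_one_smul]
      noncomm_ring
  have hconst : NormedSpace.exp (s • E) * p s * NormedSpace.exp ((-s) • E) = M := by
    ext u w
    have h1 := is_const_of_deriv_eq_zero (fun x => (hf x u w).differentiableAt)
      (fun x => (hf x u w).deriv) s 0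
    simp only [one_mul, neg_mul, zero_smul, neg_zero, NormedSpace.exp_zero, mul_one] at h1
    rw [h1]
    rcases m with _ | m
    · simp only [hp, Finset.range_zero, Finset.sum_empty]
      exact congr_fun (congr_fun h u) w |>.symm
    · simp only [hp, Finset.sum_range_succ']
      simp [adPow]
  change _ = p s
  conv_lhs => rw [← hconst, ← mul_assoc, ← mul_assoc, matrix_exp_neg_mul_exp, one_mul, mul_assoc,
    matrix_exp_neg_mul_exp, mul_one]

end MatrixDeriv

/-! ### Path-ordered exponentials of matrices -/

section MatrixPath

variable {S : Type}

/-- The matrix `M` raises the grading `d` by at least `n`. -/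
def MatrixRaises (d : S → ℕ) (n : ℕ) (M : Matrix S S ℂ) : Prop :=
  ∀ u w, M u w ≠ 0 → d w + n ≤ d u

/-- Every entry of `F` is asymptotic to the corresponding polynomial entry of `P`. -/
def MatrixCuspAsymp (F : ℂ → Matrix S S ℂ) (P : Matrix S S ℂ[X]) : Prop :=
  ∀ u w, CuspAsymp (fun z => F z u w) (P u w)

theorem CuspAsymp.eq_zero {P : ℂ[X]} (h : CuspAsymp (fun _ => 0) P) : P = 0 :=
  h.asymp.unique (by simpa using hasPolyAsymp_eval 0)

theorem regInt_zero (τ : ℂ) : regInt (fun _ => 0) τ = 0 := by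
  have h : HasPolyAsymp (fun _ => 0) 0 := by simpa using hasPolyAsymp_eval 0
  rw [regInt, regPoly_eq h]
  simp

variable [Fintype S]

theorem MatrixCuspAsymp.mul {F G : ℂ → Matrix S S ℂ} {P Q : Matrix S S ℂ[X]}
    (hF : MatrixCuspAsymp F P) (hG : MatrixCuspAsymp G Q) :
    MatrixCuspAsymp (fun z => F z * G z) (P * Q) := fun u w => by
  simp only [Matrix.mul_apply]
  exact CuspAsymp.sum fun v _ => (hF u v).mul (hG v w)

theorem MatrixRaises.mul {d : S → ℕ} {m n : ℕ} {M M' : Matrix S S ℂ} (h : MatrixRaises d m M)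
    (h' : MatrixRaises d n M') : MatrixRaises d (m + n) (M * M') := by
  intro u w hne
  rw [Matrix.mul_apply] at hne
  obtain ⟨v, -, hv⟩ := Finset.exists_ne_zero_of_sum_ne_zero hne
  have h1 := h u v (left_ne_zero_of_mul hv)
  have h2 := h' v w (right_ne_zero_of_mul hv)
  omega

/-- Columns of solutions of `D' = -D A` can be treated one after the other if `A` is strictly
triangular: when the columns of higher degree vanish, so does the right-hand side. -/
theorem eq_zero_of_triangular {Z : Set ℂ} {d : S → ℕ} {D A : ℂ → Matrix S S ℂ}
    (hA : ∀ z ∈ Z, MatrixRaises d 1 (A z))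
    (step : ∀ u w, (∀ z ∈ Z, (D z * A z) u w = 0) → ∀ z ∈ Z, D z u w = 0) :
    ∀ z ∈ Z, D z = 0 := by
  obtain ⟨b, hb⟩ := (Set.finite_range d).bddAbove
  have key : ∀ n w, b < d w + n → ∀ u, ∀ z ∈ Z, D z u w = 0 := by
    intro n
    induction n with
    | zero => exact fun w hw => absurd (hb ⟨w, rfl⟩) (by simpa using hw)
    | succ n ih =>
      intro w hw u
      refine step u w fun z hz => ?_
      rw [Matrix.mul_apply]
      refine Finset.sum_eq_zero fun v _ => ?_
      by_cases hv : A z v w = 0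
      · rw [hv, mul_zero]
      · have := hA z hz v w hv
        rw [ih v (by omega) u z hz, zero_mul]
  intro z hz
  ext u w
  exact key (b + 1) w (by omega) u z hz

/-- Uniqueness for entire solutions of `D' = -D A` with initial value at `0`. -/
theorem eq_zero_of_hasDerivAt_of_apply_zero {d : S → ℕ} {D A : ℂ → Matrix S S ℂ}
    (hA : ∀ z, MatrixRaises d 1 (A z)) (hD : ∀ z, MatrixHasDerivAt D (-(D z * A z)) z)
    (h0 : D 0 = 0) (z : ℂ) : D z = 0 := by
  refine eq_zero_of_triangular (Z := Set.univ) (fun z _ => hA z) (fun u w h z _ => ?_) z trivial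
  have h1 := is_const_of_deriv_eq_zero (fun x => (hD x u w).differentiableAt)
    (fun x => (hD x u w).deriv.trans (by rw [Matrix.neg_apply, h x trivial, neg_zero])) z 0
  rw [h1, h0, Matrix.zero_apply]

/-- Uniqueness for solutions of `D' = -D A` along vertical lines, with boundary value at the cusp.
No holomorphy is needed. -/
theorem eq_zero_of_vertical_hasDerivAt_of_tendsto {d : S → ℕ} {D A : ℂ → Matrix S S ℂ}
    (hA : ∀ z, MatrixRaises d 1 (A z))
    (hD : ∀ τ : ℂ, 0 < τ.im →
      MatrixHasDerivAt (fun t : ℝ => D (τ + t * I)) (-(I • (D τ * A τ))) 0)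
    (hlim : ∀ τ : ℂ, 0 < τ.im → Tendsto (fun t : ℝ => D (τ + t * I)) atTop (nhds 0))
    {τ : ℂ} (hτ : 0 < τ.im) : D τ = 0 := by
  refine eq_zero_of_triangular (Z := {τ : ℂ | 0 < τ.im}) (fun z _ => hA z)
    (fun u w h τ hτ => ?_) τ hτ
  have hτ' : 0 < τ.im := hτ
  have hderiv : ∀ t : ℝ, 0 ≤ t → HasDerivAt (fun t : ℝ => D (τ + t * I) u w) 0 t := fun t ht => by
    have him : 0 < (τ + t * I).im := by
      simp
      linarith
    have h1 := hD _ him u w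
    rw [Matrix.neg_apply, Matrix.smul_apply, h _ him, smul_zero, neg_zero] at h1
    have h2 := HasDerivAt.comp_sub_const (f := fun s : ℝ => D (τ + t * I + s * I) u w) t t
      (by simpa using h1)
    refine h2.congr_of_eventuallyEq (Eventually.of_forall fun s => ?_)
    change D (τ + s * I) u w = D (τ + t * I + (s - t : ℝ) * I) u w
    rw [show τ + t * I + (s - t : ℝ) * I = τ + s * I by push_cast; ring]
  have hconst : ∀ t : ℝ, 0 ≤ t → D (τ + t * I) u w = D τ u w := fun t ht => by
    have h1 := constant_of_has_deriv_right_zero (f := fun t : ℝ => D (τ + t * I) u w)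
      (a := 0) (b := t) (fun s hs => (hderiv s hs.1).continuousAt.continuousWithinAt)
      (fun s hs => (hderiv s hs.1).hasDerivWithinAt) t ⟨ht, le_rfl⟩
    simpa using h1
  have hl : Tendsto (fun t : ℝ => D (τ + t * I) u w) atTop (nhds 0) :=
    tendsto_pi_nhds.1 (tendsto_pi_nhds.1 (hlim τ hτ) u) w
  refine tendsto_nhds_unique (tendsto_const_nhds.congr' ?_) hl
  filter_upwards [eventually_ge_atTop 0] with t ht
  exact (hconst t ht).symm

variable [DecidableEq S]

/-- The iterated regularised integrals of a matrix-valued form `A`. -/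
def matrixPathTerm (A : ℂ → Matrix S S ℂ) : ℕ → ℂ → Matrix S S ℂ
  | 0 => fun _ => 1
  | n + 1 => fun τ => Matrix.of fun u w => regInt (fun z => (matrixPathTerm A n z * A z) u w) τ

/-- The polynomial asymptotics of the iterated integrals. -/
def matrixPathPoly (Q : Matrix S S ℂ[X]) : ℕ → Matrix S S ℂ[X]
  | 0 => 1
  | n + 1 => (matrixPathPoly Q n * Q).map regPrim

variable {A : ℂ → Matrix S S ℂ} {Q : Matrix S S ℂ[X]} {d : S → ℕ}

theorem matrixPathTerm_raises (hA : ∀ z, MatrixRaises d 1 (A z)) (n : ℕ) (z : ℂ) :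
    MatrixRaises d n (matrixPathTerm A n z) := by
  induction n generalizing z with
  | zero =>
    intro u w h
    change (1 : Matrix S S ℂ) u w ≠ 0 at h
    rw [Matrix.one_apply] at h
    rw [show u = w from by_contra fun h' => h (if_neg h')]
    exact le_rfl
  | succ n ih =>
    intro u w h
    by_contra hlt
    refine h ?_
    have h0 : ∀ z, (matrixPathTerm A n z * A z) u w = 0 := fun z =>
      by_contra fun h' => hlt (((ih z).mul (hA z)) u w h')
    change regInt (fun z => (matrixPathTerm A n z * A z) u w) z = 0
    simp only [h0, regInt_zero]

theorem matrixPathTerm_asymp (hA : MatrixCuspAsymp A Q) (n : ℕ) :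
    MatrixCuspAsymp (matrixPathTerm A n) (matrixPathPoly Q n) := by
  induction n with
  | zero =>
    intro u w
    simp only [matrixPathTerm, matrixPathPoly, Matrix.one_apply]
    split_ifs
    · simpa using CuspAsymp.const 1
    · simpa using CuspAsymp.const 0
  | succ n ih => exact fun u w => ((ih.mul hA) u w).regInt

theorem matrixPathTerm_hasDerivAt (hA : MatrixCuspAsymp A Q) (n : ℕ) {τ : ℂ} (hτ : 0 < τ.im) :
    MatrixHasDerivAt (fun t : ℝ => matrixPathTerm A (n + 1) (τ + t * I))
      (-(I • (matrixPathTerm A n τ * A τ))) 0 := fun u w =>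
  HasDerivAt.congr_deriv ((((matrixPathTerm_asymp hA n).mul hA) u w).hasDerivAt_regInt hτ)
    (by rw [Matrix.neg_apply, Matrix.smul_apply, smul_eq_mul, mul_comm])

/-- The path-ordered exponential, truncated after the `m`-fold iterated integrals. -/
def matrixPath (A : ℂ → Matrix S S ℂ) (m : ℕ) (z : ℂ) : Matrix S S ℂ :=
  ∑ n ∈ Finset.range (m + 1), matrixPathTerm A n z

theorem matrixPathTerm_eq_zero (hA : ∀ z, MatrixRaises d 1 (A z)) {m : ℕ} (hm : ∀ u, d u < m)
    (z : ℂ) : matrixPathTerm A m z = 0 := by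
  ext u w
  by_contra h
  have := matrixPathTerm_raises hA m z u w h
  have := hm u
  omega

/-- The path-ordered exponential `J` solves `J' = -J A` along vertical lines. -/
theorem matrixPath_hasDerivAt (hA : MatrixCuspAsymp A Q) (hR : ∀ z, MatrixRaises d 1 (A z))
    {m : ℕ} (hm : ∀ u, d u < m) {τ : ℂ} (hτ : 0 < τ.im) :
    MatrixHasDerivAt (fun t : ℝ => matrixPath A m (τ + t * I))
      (-(I • (matrixPath A m τ * A τ))) 0 := by
  simp only [matrixPath, Finset.sum_range_succ' _ m]
  refine ((MatrixHasDerivAt.sum fun n _ => matrixPathTerm_hasDerivAt hA n hτ).add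
    (MatrixHasDerivAt.const 1)).congr_deriv ?_
  rw [← Finset.sum_range_succ' (fun n => matrixPathTerm A n τ) m, Finset.sum_range_succ,
    matrixPathTerm_eq_zero hR hm, add_zero, add_zero, Finset.sum_mul, Finset.smul_sum,
    Finset.sum_neg_distrib]

/-- The polynomial asymptotics of the path-ordered exponential is determined by the differential
equation and the tangential base point condition at `0`. -/
theorem matrixPathPoly_eval (hA : MatrixCuspAsymp A Q) (hR : ∀ z, MatrixRaises d 1 (A z))
    {m : ℕ} (hm : ∀ u, d u < m) {E N : Matrix S S ℂ} {c : ℂ}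
    (hQ : ∀ z : ℂ, Q.map (Polynomial.eval z) =
      NormedSpace.exp ((-(c * z)) • E) * ((-c) • (N + E)) * NormedSpace.exp ((c * z) • E))
    (z : ℂ) :
    (∑ n ∈ Finset.range (m + 1), matrixPathPoly Q n).map (Polynomial.eval z) =
      NormedSpace.exp ((c * z) • N) * NormedSpace.exp ((c * z) • E) := by
  have hQR : ∀ z, MatrixRaises d 1 (Q.map (Polynomial.eval z)) := fun z u w h => by
    by_contra hlt
    have h0 : ∀ z, A z u w = 0 := fun z => by_contra fun h' => hlt (hR z u w h')
    have h1 := hA u w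
    simp only [h0] at h1
    exact h (by rw [Matrix.map_apply, h1.eq_zero, eval_zero])
  have hPm : matrixPathPoly Q m = 0 := by
    refine Matrix.ext fun u w => ?_
    have h1 := matrixPathTerm_asymp hA m u w
    simp only [matrixPathTerm_eq_zero hR hm, Matrix.zero_apply] at h1
    exact h1.eq_zero
  have hmul : ∀ (P : Matrix S S ℂ[X]) (z : ℂ), (P * Q).map (Polynomial.eval z) =
      P.map (Polynomial.eval z) * Q.map (Polynomial.eval z) := fun P z =>
    Matrix.map_mul (f := Polynomial.evalRingHom z)
  have hterm : ∀ n z, MatrixHasDerivAt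
      (fun z : ℂ => (matrixPathPoly Q (n + 1)).map (Polynomial.eval z))
      (-((matrixPathPoly Q n).map (Polynomial.eval z) * Q.map (Polynomial.eval z))) z :=
    fun n z u w => by
      have h1 := ((matrixPathPoly Q (n + 1)) u w).hasDerivAt z
      refine HasDerivAt.congr_deriv h1 ?_
      rw [matrixPathPoly, Matrix.map_apply, derivative_regPrim, ← hmul]
      simp
  have hsum : ∀ (z : ℂ) (k : ℕ),
      (∑ n ∈ Finset.range k, matrixPathPoly Q n).map (Polynomial.eval z) =
        ∑ n ∈ Finset.range k, (matrixPathPoly Q n).map (Polynomial.eval z) := fun z k =>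
    map_sum (Polynomial.evalRingHom z).mapMatrix _ _
  have hone : ∀ z : ℂ, (matrixPathPoly Q 0).map (Polynomial.eval z) = 1 := fun z =>
    map_one (Polynomial.evalRingHom z).mapMatrix
  have hP : ∀ z, MatrixHasDerivAt
      (fun z : ℂ => (∑ n ∈ Finset.range (m + 1), matrixPathPoly Q n).map (Polynomial.eval z))
      (-((∑ n ∈ Finset.range (m + 1), matrixPathPoly Q n).map (Polynomial.eval z) *
        Q.map (Polynomial.eval z))) z := fun z => by
    simp only [hsum]
    simp only [Finset.sum_range_succ' _ m, hone]
    refine ((MatrixHasDerivAt.sum fun n _ => hterm n z).add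
      (MatrixHasDerivAt.const 1)).congr_deriv ?_
    rw [← hone z, ← Finset.sum_range_succ'
      (fun n => (matrixPathPoly Q n).map (Polynomial.eval z)) m, Finset.sum_range_succ, hPm,
      show (0 : Matrix S S ℂ[X]).map (Polynomial.eval z) = 0 from
        map_zero (Polynomial.evalRingHom z).mapMatrix,
      add_zero, add_zero, Finset.sum_neg_distrib, Finset.sum_mul]
  have hW : ∀ z, MatrixHasDerivAt
      (fun z : ℂ => NormedSpace.exp ((c * z) • N) * NormedSpace.exp ((c * z) • E))
      (-(NormedSpace.exp ((c * z) • N) * NormedSpace.exp ((c * z) • E) *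
        Q.map (Polynomial.eval z))) z := fun z => by
    refine ((matrixHasDerivAt_exp_smul N c z).mul
      (matrixHasDerivAt_exp_smul E c z)).congr_deriv ?_
    have hc : NormedSpace.exp ((c * z) • E) * E = E * NormedSpace.exp ((c * z) • E) :=
      (((Commute.refl E).smul_left (c * z)).exp_left).eq
    have hi := matrix_exp_mul_exp_neg E (c * z)
    rw [hQ, hc, show ∀ a b b' x : Matrix S S ℂ, a * b * (b' * x * b) = a * (b * b') * x * b from
      fun a b b' x => by simp only [mul_assoc], hi]
    simp only [mul_one, mul_add, add_mul, smul_mul_assoc, mul_smul_comm, neg_smul, neg_neg,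
      mul_neg, neg_mul, smul_add, neg_add_rev, mul_assoc]
    abel
  refine sub_eq_zero.1 (eq_zero_of_hasDerivAt_of_apply_zero (d := d)
    (D := fun z => (∑ n ∈ Finset.range (m + 1), matrixPathPoly Q n).map (Polynomial.eval z) -
      NormedSpace.exp ((c * z) • N) * NormedSpace.exp ((c * z) • E)) hQR
    (fun z => ((hP z).sub (hW z)).congr_deriv ?_) ?_ z)
  · rw [sub_mul]
    abel
  · simp only [mul_zero, zero_smul, NormedSpace.exp_zero, mul_one]
    rw [hsum, Finset.sum_range_succ', hone, sub_eq_zero, add_eq_right]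
    refine Finset.sum_eq_zero fun n _ => ?_
    ext u w
    rw [matrixPathPoly, Matrix.map_apply, Matrix.map_apply, eval_zero_regPrim, Matrix.zero_apply]

/-- The behaviour of the path-ordered exponential under the translation `τ ↦ τ + 1`. Both sides
of the identity solve the same differential equation and have the same asymptotics at the cusp. -/
theorem matrixPath_add_one (hA : MatrixCuspAsymp A Q) (hR : ∀ z, MatrixRaises d 1 (A z))
    {m : ℕ} (hm : ∀ u, d u < m) {E N : Matrix S S ℂ} {c : ℂ}
    (hQ : ∀ z : ℂ, Q.map (Polynomial.eval z) =
      NormedSpace.exp ((-(c * z)) • E) * ((-c) • (N + E)) * NormedSpace.exp ((c * z) • E))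
    (hT : ∀ z : ℂ, 0 < z.im →
      A (z + 1) = NormedSpace.exp ((-c) • E) * A z * NormedSpace.exp (c • E))
    {τ : ℂ} (hτ : 0 < τ.im) :
    matrixPath A m (τ + 1) =
      NormedSpace.exp (c • N) * matrixPath A m τ * NormedSpace.exp (c • E) := by
  set W : ℂ → Matrix S S ℂ :=
    fun z => NormedSpace.exp ((c * z) • N) * NormedSpace.exp ((c * z) • E) with hW
  have hWT : ∀ z, NormedSpace.exp ((-c) • N) * W (z + 1) * NormedSpace.exp ((-c) • E) = W z :=
    fun z => by
      simp only [hW]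
      rw [show c * (z + 1) = c + c * z by ring, matrix_exp_add_smul N, add_comm c,
        matrix_exp_add_smul E]
      calc _ = NormedSpace.exp ((-c) • N) * NormedSpace.exp (c • N) *
              (NormedSpace.exp ((c * z) • N) * NormedSpace.exp ((c * z) • E)) *
              (NormedSpace.exp (c • E) * NormedSpace.exp ((-c) • E)) := by
            simp only [mul_assoc]
        _ = _ := by
            rw [matrix_exp_neg_mul_exp, matrix_exp_mul_exp_neg, one_mul, mul_one]
  have hlim : ∀ τ : ℂ, 0 < τ.im → Tendsto
      (fun t : ℝ => matrixPath A m (τ + t * I) - W (τ + t * I)) atTop (nhds 0) := fun τ hτ => by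
    refine tendsto_pi_nhds.2 fun u => tendsto_pi_nhds.2 fun w => ?_
    have h1 : CuspAsymp (fun z => matrixPath A m z u w)
        ((∑ n ∈ Finset.range (m + 1), matrixPathPoly Q n) u w) := by
      simp only [matrixPath, Matrix.sum_apply]
      exact CuspAsymp.sum fun n _ => matrixPathTerm_asymp hA n u w
    obtain ⟨b, hb, hO⟩ := h1.asymp
    refine ((hO τ hτ).trans_tendsto (Real.tendsto_exp_atBot.comp
      (tendsto_id.const_mul_atTop_of_neg (neg_lt_zero.2 hb)))).congr fun t => ?_
    have h2 := congr_fun (congr_fun (matrixPathPoly_eval hA hR hm hQ (τ + t * I)) u) w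
    rw [Matrix.map_apply] at h2
    rw [h2]
    rfl
  set D : ℂ → Matrix S S ℂ := fun z =>
    NormedSpace.exp ((-c) • N) * matrixPath A m (z + 1) * NormedSpace.exp ((-c) • E) -
      matrixPath A m z with hD
  have hD0 : D τ = 0 := by
    refine eq_zero_of_vertical_hasDerivAt_of_tendsto hR (fun τ hτ => ?_) (fun τ hτ => ?_) hτ
    · have hτ1 : 0 < (τ + 1).im := by simpa using hτ
      have h1 := matrixPath_hasDerivAt hA hR hm hτ
      have h2 := matrixPath_hasDerivAt hA hR hm hτ1
      have h3 := (((MatrixHasDerivAt.const (NormedSpace.exp ((-c) • N))).mul h2).mul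
        (MatrixHasDerivAt.const (NormedSpace.exp ((-c) • E)))).sub h1
      simp only [hD]
      simp only [add_right_comm τ 1] at h3
      refine h3.congr_deriv ?_
      have hc := matrix_exp_mul_exp_neg E c
      rw [hT τ hτ]
      simp only [zero_mul, zero_add, mul_zero, add_zero, sub_mul, smul_sub, mul_neg, neg_mul,
        mul_smul_comm, smul_mul_assoc, mul_assoc, hc, mul_one]
      abel
    · have hτ1 : 0 < (τ + 1).im := by simpa using hτ
      have h1 := ((hlim (τ + 1) hτ1).const_mul (NormedSpace.exp ((-c) • N))).mul_const
        (NormedSpace.exp ((-c) • E)) |>.sub (hlim τ hτ)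
      simp only [mul_zero, zero_mul, sub_zero] at h1
      refine h1.congr fun t => ?_
      simp only [hD]
      rw [mul_sub, sub_mul, add_right_comm τ 1, hWT]
      abel
  calc _ = NormedSpace.exp (c • N) * NormedSpace.exp ((-c) • N) * matrixPath A m (τ + 1) *
        (NormedSpace.exp ((-c) • E) * NormedSpace.exp (c • E)) := by
        rw [matrix_exp_mul_exp_neg, matrix_exp_neg_mul_exp, one_mul, mul_one]
    _ = NormedSpace.exp (c • N) * (NormedSpace.exp ((-c) • N) * matrixPath A m (τ + 1) *
        NormedSpace.exp ((-c) • E)) * NormedSpace.exp (c • E) := by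
        simp only [mul_assoc]
    _ = _ := by
        rw [sub_eq_zero.1 hD0]

end MatrixPath

/-! ### The path-ordered exponential of the modular connection form -/

section FormMatrix

variable {S : Type} {d : S → ℕ}

namespace MatrixRaises

variable {m n : ℕ} {M M' : Matrix S S ℂ}

theorem zero_matrix : MatrixRaises d n (0 : Matrix S S ℂ) := fun _ _ h => (h rfl).elim

theorem add (h : MatrixRaises d n M) (h' : MatrixRaises d n M') : MatrixRaises d n (M + M') := by
  intro u w hne
  by_cases h1 : M u w = 0
  · exact h' u w fun h2 => hne (by simp [h1, h2])
  · exact h u w h1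

theorem smul (h : MatrixRaises d n M) (c : ℂ) : MatrixRaises d n (c • M) := fun u w hne =>
  h u w fun h2 => hne (by simp [h2])

theorem sub (h : MatrixRaises d n M) (h' : MatrixRaises d n M') : MatrixRaises d n (M - M') := by
  simpa [sub_eq_add_neg] using h.add (h'.smul (-1))

theorem sum {ι : Type*} {s : Finset ι} {f : ι → Matrix S S ℂ}
    (h : ∀ i ∈ s, MatrixRaises d n (f i)) : MatrixRaises d n (∑ i ∈ s, f i) := by
  classical
  induction s using Finset.induction_on with
  | empty => simpa using zero_matrix
  | insert a s ha ih =>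
    rw [Finset.sum_insert ha]
    exact (h a (by simp)).add (ih fun i hi => h i (by simp [hi]))

theorem adPow [Fintype S] [DecidableEq S] (hM : MatrixRaises d 0 M) (hM' : MatrixRaises d n M')
    (j : ℕ) : MatrixRaises d n (adPow M j M') := by
  induction j with
  | zero => exact hM'
  | succ j ih =>
    rw [adPow_succ]
    exact (by simpa using hM.mul ih : MatrixRaises d n _).sub (by simpa using ih.mul hM)

end MatrixRaises

variable [Fintype S] [DecidableEq S]

/-- Matrices `E`, `e k` and `e_Δ` playing the roles of `e_0`, `e_k` and `e_Δ` for the weights in a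
finite set: `e k` and `e_Δ` raise the grading `d` and are annihilated by `ad_E^{k-1}`. -/
structure MatrixLetters (d : S → ℕ) (K : Finset EvenWt) (B : CuspForms) (E : Matrix S S ℂ)
    (e : EvenWt → Matrix S S ℂ) (eD : ∀ k : EvenWt, CuspForm 𝒮ℒ (k.1 : ℤ) → Matrix S S ℂ) :
    Prop where
  raises_E : MatrixRaises d 0 E
  raises_e : ∀ k ∈ K, MatrixRaises d 1 (e k)
  raises_eD : ∀ k ∈ K, ∀ Δ ∈ B k, MatrixRaises d 1 (eD k Δ)
  adPow_e : ∀ k ∈ K, adPow E (k.1 - 1) (e k) = 0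
  adPow_eD : ∀ k ∈ K, ∀ Δ ∈ B k, adPow E (k.1 - 1) (eD k Δ) = 0

variable (K : Finset EvenWt) (B : CuspForms) (E : Matrix S S ℂ) (e : EvenWt → Matrix S S ℂ)
  (eD : ∀ k : EvenWt, CuspForm 𝒮ℒ (k.1 : ℤ) → Matrix S S ℂ)

/-- The shape of the connection form, with numbers `g k` and `h k Δ` in place of the values of
`G_k` and `Δ`. -/
def formMatrix (g : EvenWt → ℂ) (h : ∀ k : EvenWt, CuspForm 𝒮ℒ (k.1 : ℤ) → ℂ) (s : ℂ) :
    Matrix S S ℂ :=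
  ∑ k ∈ K, ∑ j ∈ Finset.range (k.1 - 1),
    ((-1 : ℂ) ^ j * ((k.1 : ℂ) - 1) / (j.factorial : ℂ)) •
      (((2 * Real.pi * I) ^ (1 + (j : ℤ) - (k.1 : ℤ)) * s ^ j * g k) • adPow E j (e k)
        + ∑ Δ ∈ B k, ((2 * Real.pi * I) ^ (1 + j) * s ^ j * h k Δ) • adPow E j (eD k Δ))

/-- The connection form as a matrix-valued function. -/
def connMatrix (z : ℂ) : Matrix S S ℂ :=
  formMatrix K B E e eD (fun k => Gk k.1 z) (fun _ Δ => Δ (UpperHalfPlane.ofComplex z)) z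

/-- The matrix `N` whose exponential describes the monodromy at the cusp. -/
def nMatrix : Matrix S S ℂ :=
  -E + ∑ k ∈ K, (((k.1 : ℂ) - 1) * ((bernoulli k.1 : ℚ) : ℂ) / (k.1.factorial : ℂ)) • e k

variable {K B E e eD}

/-- Summing over the multiplets turns the powers of `s` into conjugation by `exp (2πi s E)`. -/
theorem formMatrix_eq_conj (hL : MatrixLetters d K B E e eD) (g : EvenWt → ℂ)
    (h : ∀ k : EvenWt, CuspForm 𝒮ℒ (k.1 : ℤ) → ℂ) (s : ℂ) :
    formMatrix K B E e eD g h s =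
      NormedSpace.exp ((-(2 * Real.pi * I * s)) • E) *
        (∑ k ∈ K, ((k.1 : ℂ) - 1) • (((2 * Real.pi * I) ^ (1 - (k.1 : ℤ)) * g k) • e k
          + ∑ Δ ∈ B k, ((2 * Real.pi * I) * h k Δ) • eD k Δ)) *
        NormedSpace.exp ((2 * Real.pi * I * s) • E) := by
  rw [Finset.mul_sum, Finset.sum_mul, formMatrix]
  refine Finset.sum_congr rfl fun k hk => ?_
  simp only [mul_smul_comm, smul_mul_assoc, mul_add, add_mul, Finset.mul_sum, Finset.sum_mul]
  have hc : (2 * Real.pi * I : ℂ) ≠ 0 := by simp [Real.pi_ne_zero]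
  have hD : ∑ Δ ∈ B k, (2 * Real.pi * I * h k Δ) •
        (NormedSpace.exp ((-(2 * Real.pi * I * s)) • E) * eD k Δ *
          NormedSpace.exp ((2 * Real.pi * I * s) • E)) =
      ∑ Δ ∈ B k, (2 * Real.pi * I * h k Δ) • ∑ j ∈ Finset.range (k.1 - 1),
        ((-(2 * Real.pi * I * s)) ^ j / (j.factorial : ℂ)) • adPow E j (eD k Δ) :=
    Finset.sum_congr rfl fun Δ hΔ => by
      rw [exp_conj_eq_sum_adPow (hL.adPow_eD k hk Δ hΔ)]
  rw [exp_conj_eq_sum_adPow (hL.adPow_e k hk), hD]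
  simp only [smul_add, Finset.sum_add_distrib, Finset.smul_sum, smul_smul]
  congr 1
  · refine Finset.sum_congr rfl fun j _ => ?_
    congr 1
    rw [show 1 + (j : ℤ) - (k.1 : ℤ) = 1 - (k.1 : ℤ) + j by ring, zpow_add₀ hc, zpow_natCast]
    rw [neg_pow (2 * Real.pi * I * s), mul_pow (2 * Real.pi * I : ℂ)]
    ring
  · rw [Finset.sum_comm]
    refine Finset.sum_congr rfl fun Δ _ => Finset.sum_congr rfl fun j _ => ?_
    congr 1
    rw [neg_pow (2 * Real.pi * I * s), mul_pow (2 * Real.pi * I : ℂ), pow_add, pow_one]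
    ring

theorem connMatrix_raises (hL : MatrixLetters d K B E e eD) (z : ℂ) :
    MatrixRaises d 1 (connMatrix K B E e eD z) :=
  MatrixRaises.sum fun k hk => MatrixRaises.sum fun j _ => MatrixRaises.smul
    (((hL.raises_E.adPow (hL.raises_e k hk) j).smul _).add (MatrixRaises.sum fun Δ hΔ =>
      (hL.raises_E.adPow (hL.raises_eD k hk Δ hΔ) j).smul _)) _

theorem connMatrix_add_one (hL : MatrixLetters d K B E e eD) (z : ℂ) :
    connMatrix K B E e eD (z + 1) = NormedSpace.exp ((-(2 * Real.pi * I)) • E) *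
      connMatrix K B E e eD z * NormedSpace.exp ((2 * Real.pi * I) • E) := by
  have h1 : ∀ k : EvenWt, Gk k.1 (z + 1) = Gk k.1 z := fun k => Gk_add_one k.1 z
  have h2 : ∀ (k : EvenWt) (Δ : CuspForm 𝒮ℒ (k.1 : ℤ)), Δ (UpperHalfPlane.ofComplex (z + 1)) =
      Δ (UpperHalfPlane.ofComplex z) := fun k Δ => modularForm_add_one Δ z
  rw [connMatrix, connMatrix, formMatrix_eq_conj hL, formMatrix_eq_conj hL]
  simp only [h1, h2]
  rw [show -(2 * Real.pi * I * (z + 1)) = -(2 * Real.pi * I) + -(2 * Real.pi * I * z) by ring,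
    show 2 * Real.pi * I * (z + 1) = 2 * Real.pi * I * z + 2 * Real.pi * I by ring,
    matrix_exp_add_smul, matrix_exp_add_smul]
  simp only [mul_assoc]

/-- The asymptotics of the connection form: `G_k` tends to `2 ζ(k)` and `Δ` to `0`, which leaves
`-2πi (N + E)` conjugated by `exp (2πi z E)`. -/
theorem exists_connMatrix_asymp (hL : MatrixLetters d K B E e eD) :
    ∃ Q : Matrix S S ℂ[X], MatrixCuspAsymp (connMatrix K B E e eD) Q ∧
      ∀ z : ℂ, Q.map (Polynomial.eval z) =
        NormedSpace.exp ((-(2 * Real.pi * I * z)) • E) *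
          ((-(2 * Real.pi * I)) • (nMatrix K E e + E)) *
          NormedSpace.exp ((2 * Real.pi * I * z) • E) := by
  set g : EvenWt → ℂ := fun k =>
    -((2 * Real.pi * I) ^ k.1 * (bernoulli k.1 : ℚ) / (k.1.factorial : ℂ)) with hg
  refine ⟨Matrix.of fun u w => ∑ k ∈ K, ∑ j ∈ Finset.range (k.1 - 1),
    C ((-1 : ℂ) ^ j * ((k.1 : ℂ) - 1) / (j.factorial : ℂ)) *
      (C ((2 * Real.pi * I) ^ (1 + (j : ℤ) - (k.1 : ℤ))) * X ^ j * C (g k) *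
          C (adPow E j (e k) u w)
        + ∑ Δ ∈ B k, C ((2 * Real.pi * I) ^ (1 + j)) * X ^ j * 0 * C (adPow E j (eD k Δ) u w)),
    fun u w => ?_, fun z => ?_⟩
  · simp only [connMatrix, formMatrix, Matrix.sum_apply, Matrix.smul_apply, Matrix.add_apply,
      smul_eq_mul, Matrix.of_apply]
    have hX : ∀ j : ℕ, CuspAsymp (fun z => z ^ j) (X ^ j) := fun j => by
      simpa using CuspAsymp.eval (X ^ j)
    exact CuspAsymp.sum fun k _ => CuspAsymp.sum fun j _ => (CuspAsymp.const _).mul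
      (((((CuspAsymp.const _).mul (hX j)).mul (cuspAsymp_Gk k.2.1 k.2.2)).mul
        (CuspAsymp.const _)).add (CuspAsymp.sum fun Δ _ =>
          (((CuspAsymp.const _).mul (hX j)).mul (cuspAsymp_cuspForm Δ)).mul (CuspAsymp.const _)))
  · have h1 : formMatrix K B E e eD g 0 z = NormedSpace.exp ((-(2 * Real.pi * I * z)) • E) *
          ((-(2 * Real.pi * I)) • (nMatrix K E e + E)) *
          NormedSpace.exp ((2 * Real.pi * I * z) • E) := by
      rw [formMatrix_eq_conj hL, nMatrix, neg_add_eq_sub, sub_add_cancel, Finset.smul_sum]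
      congr 2
      refine Finset.sum_congr rfl fun k _ => ?_
      have hc : (2 * Real.pi * I : ℂ) ≠ 0 := by simp [Real.pi_ne_zero]
      simp only [Pi.zero_apply, mul_zero, zero_smul, Finset.sum_const_zero, add_zero, smul_smul]
      congr 1
      rw [hg, zpow_sub₀ hc, zpow_one, zpow_natCast]
      have := pow_ne_zero k.1 hc
      generalize (2 * Real.pi * I : ℂ) = c at *
      field_simp
    rw [← h1]
    refine Matrix.ext fun u w => ?_
    simp only [formMatrix, Matrix.sum_apply, Matrix.smul_apply, Matrix.add_apply,
      smul_eq_mul, Matrix.of_apply, Matrix.map_apply, eval_finsetSum, eval_mul, eval_add, eval_C,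
      eval_pow, eval_X, eval_zero, Pi.zero_apply]

theorem regIntegrable_matrixPathTerm_mul (hL : MatrixLetters d K B E e eD) (n : ℕ) (u w : S) :
    RegIntegrable fun z =>
      (matrixPathTerm (connMatrix K B E e eD) n z * connMatrix K B E e eD z) u w := by
  obtain ⟨Q, hQ, -⟩ := exists_connMatrix_asymp hL
  exact (((matrixPathTerm_asymp hQ n).mul hQ) u w).regIntegrable

theorem matrixPath_connMatrix_add_one (hL : MatrixLetters d K B E e eD) {m : ℕ}
    (hm : ∀ u, d u < m) {τ : ℂ} (hτ : 0 < τ.im) :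
    matrixPath (connMatrix K B E e eD) m (τ + 1) =
      NormedSpace.exp ((2 * Real.pi * I : ℂ) • nMatrix K E e) *
        matrixPath (connMatrix K B E e eD) m τ *
        NormedSpace.exp ((2 * Real.pi * I : ℂ) • E) := by
  obtain ⟨Q, hQ, hQ'⟩ := exists_connMatrix_asymp hL
  exact matrixPath_add_one hQ (connMatrix_raises hL) hm hQ'
    (fun z _ => connMatrix_add_one hL z) hτ

end FormMatrix

/-! ### The generating series, truncated to finite matrices -/

section GeneratingSeries

open Matrix

variable {X : Type} [GradedAlphabet X]

/-- What the transformation laws need to know of `e_0` and `e_k`: the degree of `e_k`, and that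
`e_k` lies in a multiplet of dimension `k - 1` under `e_0`. -/
structure IsEisensteinMultiplets (L : Letters X) : Prop where
  raises : ∀ k, RaisesBy k.1 (L.e k)
  nilpotent : ∀ k, adPow L.e0 (k.1 - 1) (L.e k) = 0

variable {L : Letters X} {B : CuspForms} {eP eM eD : CuspLetters X}

theorem RaisesBy.matrixRaises {n : ℕ} {x : Op X} (h : RaisesBy n x) (N : ℕ) :
    MatrixRaises (fun u : LowWord X N => u.1.deg) n (trunc N x) :=
  fun u w hne => h u.1 w.1 hne

/-- The adjoint matrix raises the opposite degree. -/
theorem RaisesBy.matrixRaises_conjTranspose {n : ℕ} {x : Op X} (h : RaisesBy n x) (N : ℕ) :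
    MatrixRaises (fun u : LowWord X N => N - u.1.deg) n (trunc N x)ᴴ := fun u w hne => by
  have h1 := h w.1 u.1 fun h0 => hne (by simp [h0])
  have := w.2
  have := u.2
  simp only
  omega

theorem finite_not_raisesBy (hL : IsEisensteinMultiplets L) (hD : IsCuspMultiplets L B eD)
    (D : ℕ) :
    {k : EvenWt | ¬ RaisesBy D (L.e k) ∨ ∃ Δ ∈ B k, ¬ RaisesBy D (eD k Δ)}.Finite := by
  refine Set.Finite.union (s := {k | ¬ RaisesBy D (L.e k)})
    (t := {k | ∃ Δ ∈ B k, ¬ RaisesBy D (eD k Δ)}) ?_ ?_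
  · refine Set.Finite.of_finite_image ((Set.finite_lt_nat D).subset ?_)
      (f := Subtype.val) Subtype.val_injective.injOn
    rintro _ ⟨k, hk, rfl⟩
    by_contra hlt
    exact hk ((hL.raises k).mono (not_lt.1 hlt))
  · refine ((hD.admissible.2 D).image Sigma.fst).subset ?_
    rintro k ⟨Δ, hΔ, h⟩
    exact ⟨⟨k, ⟨Δ, hΔ⟩⟩, h, rfl⟩

/-- The weights that contribute to the words of degree at most `N`. -/
def lowWeights (hL : IsEisensteinMultiplets L) (hD : IsCuspMultiplets L B eD) (N : ℕ) :
    Finset EvenWt :=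
  (finite_not_raisesBy hL hD (N + 1)).toFinset

theorem raisesBy_of_notMem_lowWeights {hL : IsEisensteinMultiplets L}
    {hD : IsCuspMultiplets L B eD} {N : ℕ} {k : EvenWt} (hk : k ∉ lowWeights hL hD N) :
    RaisesBy (N + 1) (L.e k) ∧ ∀ Δ ∈ B k, RaisesBy (N + 1) (eD k Δ) := by
  simpa [lowWeights] using hk

theorem AplusWt_raisesBy {n : ℕ} {k : EvenWt} (he : RaisesBy n (L.e k))
    (hD : ∀ Δ ∈ B k, RaisesBy n (eP k Δ)) (z : ℂ) : RaisesBy n (AplusWt L B eP k z) :=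
  RaisesBy.sum fun _ _ => (((he.adPow _ _).smul _).add
    (RaisesBy.sum fun Δ hΔ => ((hD Δ hΔ).adPow _ _).smul _)).smul _

theorem AminusWt_raisesBy {n : ℕ} {k : EvenWt} (he : RaisesBy n (L.e k))
    (hD : ∀ Δ ∈ B k, RaisesBy n (eM k Δ)) (z : ℂ) : RaisesBy n (AminusWt L B eM k z) :=
  RaisesBy.sum fun _ _ => (((he.adPow _ _).smul _).add
    (RaisesBy.sum fun Δ hΔ => ((hD Δ hΔ).adPow _ _).smul _)).smul _

theorem summable_AplusWt (hL : IsEisensteinMultiplets L) (hP : IsCuspMultiplets L B eP) (z : ℂ) :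
    Summable fun k => AplusWt L B eP k z :=
  op_summable_of_finite fun D => (finite_not_raisesBy hL hP D).subset fun k hk => by
    by_contra h
    simp only [Set.mem_ofPred_eq, not_or, not_exists, not_and, not_not] at h
    exact hk (AplusWt_raisesBy h.1 h.2 z)

theorem summable_AminusWt (hL : IsEisensteinMultiplets L) (hM : IsCuspMultiplets L B eM) (z : ℂ) :
    Summable fun k => AminusWt L B eM k z :=
  op_summable_of_finite fun D => (finite_not_raisesBy hL hM D).subset fun k hk => by
    by_contra h
    simp only [Set.mem_ofPred_eq, not_or, not_exists, not_and, not_not] at h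
    exact hk (AminusWt_raisesBy h.1 h.2 z)

theorem NhatTerm_raisesBy {n : ℕ} {k : EvenWt} (he : RaisesBy n (L.e k)) :
    RaisesBy n (NhatTerm L k) := he.smul _

theorem summable_NhatTerm (hL : IsEisensteinMultiplets L) : Summable (NhatTerm L) :=
  op_summable_of_finite fun D => by
    refine Set.Finite.of_finite_image ((Set.finite_lt_nat D).subset ?_)
      (f := Subtype.val) Subtype.val_injective.injOn
    rintro _ ⟨k, hk, rfl⟩
    by_contra hlt
    exact hk (NhatTerm_raisesBy ((hL.raises k).mono (not_lt.1 hlt)))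

theorem trunc_Aplus (hL : IsEisensteinMultiplets L) (hP : IsCuspMultiplets L B eP) (N : ℕ) (z : ℂ) :
    trunc N (Aplus L B eP z) = connMatrix (lowWeights hL hP N) B (trunc N L.e0)
      (fun k => trunc N (L.e k)) (fun k Δ => trunc N (eP k Δ)) z := by
  rw [Aplus, trunc_tsum (summable_AplusWt hL hP z), tsum_eq_sum (s := lowWeights hL hP N)]
  · simp only [AplusWt, nuEis, nuCusp, map_sum, map_smul, map_add, trunc_adPow, connMatrix,
      formMatrix]
  · intro k hk
    have h := raisesBy_of_notMem_lowWeights hk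
    exact (AplusWt_raisesBy h.1 h.2 z).trunc_eq_zero (Nat.lt_succ_self N)

theorem trunc_Nhat (hL : IsEisensteinMultiplets L) (hD : IsCuspMultiplets L B eD) (N : ℕ) :
    trunc N (Nhat L) =
      nMatrix (lowWeights hL hD N) (trunc N L.e0) (fun k => trunc N (L.e k)) := by
  rw [Nhat, map_add, map_neg, trunc_tsum (summable_NhatTerm hL),
    tsum_eq_sum (s := lowWeights hL hD N), nMatrix]
  · simp only [NhatTerm, map_smul]
  · intro k hk
    exact (NhatTerm_raisesBy (raisesBy_of_notMem_lowWeights hk).1).trunc_eq_zero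
      (Nat.lt_succ_self N)

theorem adPow_conjTranspose {S : Type} [Fintype S] [DecidableEq S] (x y : Matrix S S ℂ) (j : ℕ) :
    (adPow x j y)ᴴ = (-1 : ℂ) ^ j • adPow xᴴ j yᴴ := by
  induction j with
  | zero => simp [adPow]
  | succ j ih =>
    rw [adPow_succ, adPow_succ, conjTranspose_sub, conjTranspose_mul, conjTranspose_mul, ih,
      pow_succ, mul_neg_one, neg_smul, smul_sub, mul_smul_comm, smul_mul_assoc]
    abel

/-- Adjunction turns `A_-` into a form of the shape of `A_+`. -/
theorem trunc_Aminus_conjTranspose (hL : IsEisensteinMultiplets L) (hM : IsCuspMultiplets L B eM)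
    (N : ℕ) (z : ℂ) :
    (trunc N (Aminus L B eM z))ᴴ = connMatrix (lowWeights hL hM N) B (trunc N L.e0)ᴴ
      (fun k => (trunc N (L.e k))ᴴ) (fun k Δ => (trunc N (eM k Δ))ᴴ) z := by
  rw [Aminus, trunc_tsum (summable_AminusWt hL hM z), tsum_eq_sum (s := lowWeights hL hM N)]
  · simp only [AminusWt, map_sum, map_smul, map_add, trunc_adPow, connMatrix, formMatrix,
      conjTranspose_sum, conjTranspose_smul, conjTranspose_add, adPow_conjTranspose]
    refine Finset.sum_congr rfl fun k _ => Finset.sum_congr rfl fun j _ => ?_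
    have h1 : star (((k.1 : ℂ) - 1) / (j.factorial : ℂ)) = ((k.1 : ℂ) - 1) / (j.factorial : ℂ) := by
      simp
    have h2 : ∀ x : ℂ, star ((starRingEnd ℂ) x) = x := fun x => star_star x
    rw [h1]
    simp only [h2, nuEis, nuCusp, smul_add, Finset.smul_sum, smul_smul]
    congr 1
    · congr 1
      ring
    · refine Finset.sum_congr rfl fun Δ _ => ?_
      congr 1
      ring
  · intro k hk
    have h := raisesBy_of_notMem_lowWeights hk
    exact (AminusWt_raisesBy h.1 h.2 z).trunc_eq_zero (Nat.lt_succ_self N)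

theorem nMatrix_conjTranspose {S : Type} [Fintype S] [DecidableEq S] (K : Finset EvenWt)
    (E : Matrix S S ℂ) (e : EvenWt → Matrix S S ℂ) :
    nMatrix K Eᴴ (fun k => (e k)ᴴ) = (nMatrix K E e)ᴴ := by
  rw [nMatrix, nMatrix, conjTranspose_add, conjTranspose_neg, conjTranspose_sum]
  congr 1
  refine Finset.sum_congr rfl fun k _ => ?_
  rw [conjTranspose_smul]
  congr 1
  simp

theorem matrixLetters_trunc (hL : IsEisensteinMultiplets L) (hP : IsCuspMultiplets L B eP)
    (N : ℕ) : MatrixLetters (fun u : LowWord X N => u.1.deg) (lowWeights hL hP N) B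
      (trunc N L.e0) (fun k => trunc N (L.e k)) (fun k Δ => trunc N (eP k Δ)) where
  raises_E := (raisesBy_zero _).matrixRaises N
  raises_e k _ := ((hL.raises k).mono (le_trans (by norm_num) k.2.1)).matrixRaises N
  raises_eD k _ Δ hΔ := (hP.admissible.1 ⟨k, ⟨Δ, hΔ⟩⟩).matrixRaises N
  adPow_e k _ := by rw [← trunc_adPow, hL.nilpotent, map_zero]
  adPow_eD k _ Δ hΔ := by rw [← trunc_adPow, hP.nilpotent k Δ hΔ, map_zero]

theorem matrixLetters_trunc_conjTranspose (hL : IsEisensteinMultiplets L)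
    (hM : IsCuspMultiplets L B eM) (N : ℕ) :
    MatrixLetters (fun u : LowWord X N => N - u.1.deg) (lowWeights hL hM N) B
      (trunc N L.e0)ᴴ (fun k => (trunc N (L.e k))ᴴ) (fun k Δ => (trunc N (eM k Δ))ᴴ) := by
  have key : ∀ (j : ℕ) (x y : Matrix (LowWord X N) (LowWord X N) ℂ), adPow x j y = 0 →
      adPow xᴴ j yᴴ = 0 := fun j x y h => by
    have h1 := adPow_conjTranspose x y j
    rw [h, conjTranspose_zero] at h1
    exact (smul_eq_zero.1 h1.symm).resolve_left (pow_ne_zero _ (by norm_num))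
  exact
    { raises_E := (raisesBy_zero _).matrixRaises_conjTranspose N
      raises_e := fun k _ =>
        ((hL.raises k).mono (le_trans (by norm_num) k.2.1)).matrixRaises_conjTranspose N
      raises_eD := fun k _ Δ hΔ => (hM.admissible.1 ⟨k, ⟨Δ, hΔ⟩⟩).matrixRaises_conjTranspose N
      adPow_e := fun k _ => key _ _ _ (by rw [← trunc_adPow, hL.nilpotent, map_zero])
      adPow_eD := fun k _ Δ hΔ =>
        key _ _ _ (by rw [← trunc_adPow, hM.nilpotent k Δ hΔ, map_zero]) }

theorem trunc_opRegInt (N : ℕ) (F : ℂ → Op X) (τ : ℂ) :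
    trunc N (opRegInt F τ) = Matrix.of fun u w => regInt (fun z => trunc N (F z) u w) τ := by
  ext u w
  rw [trunc_apply, Matrix.of_apply, opRegInt, IncidenceAlgebra.coe_mk]
  split_ifs with h
  · rfl
  · simp only [trunc_apply, IncidenceAlgebra.apply_eq_zero_of_not_le h, regInt_zero]

theorem trunc_opRegIntConj_conjTranspose (N : ℕ) (F : ℂ → Op X) (τ : ℂ) :
    (trunc N (opRegIntConj F τ))ᴴ =
      Matrix.of fun u w => regInt (fun z => (trunc N (F z))ᴴ u w) τ := by
  ext u w
  rw [conjTranspose_apply, trunc_apply, Matrix.of_apply, opRegIntConj, IncidenceAlgebra.coe_mk]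
  split_ifs with h
  · exact star_star _
  · simp only [conjTranspose_apply, trunc_apply, IncidenceAlgebra.apply_eq_zero_of_not_le h,
      star_zero, regInt_zero]

theorem trunc_IplusTerm (hL : IsEisensteinMultiplets L) (hP : IsCuspMultiplets L B eP) (N n : ℕ)
    (z : ℂ) : trunc N (IplusTerm L B eP n z) =
      matrixPathTerm (connMatrix (lowWeights hL hP N) B (trunc N L.e0)
        (fun k => trunc N (L.e k)) (fun k Δ => trunc N (eP k Δ))) n z := by
  induction n generalizing z with
  | zero => exact map_one _
  | succ n ih =>
    rw [IplusTerm, trunc_opRegInt, matrixPathTerm]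
    simp only [map_mul, ih, trunc_Aplus hL hP]

theorem trunc_ItildeMinusTerm_conjTranspose (hL : IsEisensteinMultiplets L)
    (hM : IsCuspMultiplets L B eM) (N n : ℕ) (z : ℂ) :
    (trunc N (ItildeMinusTerm L B eM n z))ᴴ =
      matrixPathTerm (connMatrix (lowWeights hL hM N) B (trunc N L.e0)ᴴ
        (fun k => (trunc N (L.e k))ᴴ) (fun k Δ => (trunc N (eM k Δ))ᴴ)) n z := by
  induction n generalizing z with
  | zero => exact (congr_arg _ (map_one (trunc N))).trans conjTranspose_one
  | succ n ih =>
    rw [ItildeMinusTerm, trunc_opRegIntConj_conjTranspose, matrixPathTerm]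
    simp only [map_mul, conjTranspose_mul, ih, trunc_Aminus_conjTranspose hL hM]

theorem trunc_IplusTerm_eq_zero (hL : IsEisensteinMultiplets L) (hP : IsCuspMultiplets L B eP)
    {N n : ℕ} (hn : N < n) (z : ℂ) : trunc N (IplusTerm L B eP n z) = 0 := by
  rw [trunc_IplusTerm hL hP]
  exact matrixPathTerm_eq_zero (connMatrix_raises (matrixLetters_trunc hL hP N))
    (fun u => lt_of_le_of_lt u.2 hn) z

theorem trunc_ItildeMinusTerm_eq_zero (hL : IsEisensteinMultiplets L)
    (hM : IsCuspMultiplets L B eM) {N n : ℕ} (hn : N < n) (z : ℂ) :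
    trunc N (ItildeMinusTerm L B eM n z) = 0 := by
  rw [← conjTranspose_eq_zero, trunc_ItildeMinusTerm_conjTranspose hL hM]
  exact matrixPathTerm_eq_zero (connMatrix_raises (matrixLetters_trunc_conjTranspose hL hM N))
    (fun u => lt_of_le_of_lt (Nat.sub_le _ _) hn) z

theorem summable_IplusTerm (hL : IsEisensteinMultiplets L) (hP : IsCuspMultiplets L B eP) (z : ℂ) :
    Summable fun n => IplusTerm L B eP n z :=
  op_summable_iff_trunc.2 fun N => summable_of_ne_finset_zero (s := Finset.range (N + 1))
    fun n hn => trunc_IplusTerm_eq_zero hL hP (by simpa using hn) z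

theorem summable_ItildeMinusTerm (hL : IsEisensteinMultiplets L) (hM : IsCuspMultiplets L B eM)
    (z : ℂ) : Summable fun n => ItildeMinusTerm L B eM n z :=
  op_summable_iff_trunc.2 fun N => summable_of_ne_finset_zero (s := Finset.range (N + 1))
    fun n hn => trunc_ItildeMinusTerm_eq_zero hL hM (by simpa using hn) z

theorem trunc_Iplus (hL : IsEisensteinMultiplets L) (hP : IsCuspMultiplets L B eP) (N : ℕ)
    (z : ℂ) : trunc N (Iplus L B eP z) =
      matrixPath (connMatrix (lowWeights hL hP N) B (trunc N L.e0)
        (fun k => trunc N (L.e k)) (fun k Δ => trunc N (eP k Δ))) (N + 1) z := by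
  rw [Iplus, trunc_tsum (summable_IplusTerm hL hP z), matrixPath,
    tsum_eq_sum (s := Finset.range (N + 1 + 1))]
  · exact Finset.sum_congr rfl fun n _ => trunc_IplusTerm hL hP N n z
  · intro n hn
    exact trunc_IplusTerm_eq_zero hL hP (by simp at hn; omega) z

theorem trunc_ItildeMinus_conjTranspose (hL : IsEisensteinMultiplets L)
    (hM : IsCuspMultiplets L B eM) (N : ℕ) (z : ℂ) :
    (trunc N (ItildeMinus L B eM z))ᴴ =
      matrixPath (connMatrix (lowWeights hL hM N) B (trunc N L.e0)ᴴ
        (fun k => (trunc N (L.e k))ᴴ) (fun k Δ => (trunc N (eM k Δ))ᴴ)) (N + 1) z := by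
  rw [ItildeMinus, trunc_tsum (summable_ItildeMinusTerm hL hM z), matrixPath,
    tsum_eq_sum (s := Finset.range (N + 1 + 1)), conjTranspose_sum]
  · exact Finset.sum_congr rfl fun n _ => trunc_ItildeMinusTerm_conjTranspose hL hM N n z
  · intro n hn
    exact trunc_ItildeMinusTerm_eq_zero hL hM (by simp at hn; omega) z

/-! ### Translation of the path-ordered series -/

theorem Iplus_add_one (hL : IsEisensteinMultiplets L) (hP : IsCuspMultiplets L B eP) {τ : ℂ}
    (hτ : 0 < τ.im) :
    Iplus L B eP (τ + 1) = exp2piI (Nhat L) * Iplus L B eP τ * exp2piI L.e0 :=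
  op_ext_trunc fun N => by
    rw [map_mul, map_mul, trunc_Iplus hL hP, trunc_Iplus hL hP, exp2piI, exp2piI, trunc_opExp,
      trunc_opExp, map_smul, map_smul, trunc_Nhat hL hP]
    exact matrixPath_connMatrix_add_one (matrixLetters_trunc hL hP N)
      (fun u => Nat.lt_succ_of_le u.2) hτ

theorem ItildeMinus_add_one (hL : IsEisensteinMultiplets L) (hM : IsCuspMultiplets L B eM) {τ : ℂ}
    (hτ : 0 < τ.im) :
    ItildeMinus L B eM (τ + 1) = expNeg2piI L.e0 * ItildeMinus L B eM τ * expNeg2piI (Nhat L) :=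
  op_ext_trunc fun N => by
    have hexp : ∀ x : Matrix (LowWord X N) (LowWord X N) ℂ,
        (NormedSpace.exp ((-(2 * Real.pi * I) : ℂ) • x))ᴴ =
          NormedSpace.exp ((2 * Real.pi * I : ℂ) • xᴴ) := fun x => by
      rw [← Matrix.exp_conjTranspose, conjTranspose_smul]
      congr 2
      simp
    apply conjTranspose_injective
    rw [map_mul, map_mul, conjTranspose_mul, conjTranspose_mul,
      trunc_ItildeMinus_conjTranspose hL hM, trunc_ItildeMinus_conjTranspose hL hM, expNeg2piI,
      expNeg2piI, trunc_opExp, trunc_opExp, map_smul, map_smul, hexp, hexp, trunc_Nhat hL hM,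
      ← nMatrix_conjTranspose, ← mul_assoc]
    exact matrixPath_connMatrix_add_one (matrixLetters_trunc_conjTranspose hL hM N)
      (fun u => Nat.lt_succ_of_le (Nat.sub_le _ _)) hτ

/-! ### Existence of the regularised integrals -/

theorem regIntegrable_zero : RegIntegrable fun _ => 0 := (CuspAsymp.const 0).regIntegrable

theorem regIntegrable_IplusTerm_mul (hL : IsEisensteinMultiplets L)
    (hP : IsCuspMultiplets L B eP) (n : ℕ) (u w : Word X) :
    RegIntegrable fun τ => (IplusTerm L B eP n τ * Aplus L B eP τ) u w := by
  by_cases h : u ≤ w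
  · have h1 := regIntegrable_matrixPathTerm_mul (matrixLetters_trunc hL hP u.deg) n ⟨u, le_rfl⟩
      ⟨w, Word.le_def.1 h⟩
    simp only [← trunc_IplusTerm, ← trunc_Aplus, ← map_mul] at h1
    exact h1
  · simp only [IncidenceAlgebra.apply_eq_zero_of_not_le h]
    exact regIntegrable_zero

theorem regIntegrable_mul_ItildeMinusTerm (hL : IsEisensteinMultiplets L)
    (hM : IsCuspMultiplets L B eM) (n : ℕ) (u w : Word X) :
    RegIntegrable fun τ =>
      (starRingEnd ℂ) ((Aminus L B eM τ * ItildeMinusTerm L B eM n τ) u w) := by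
  by_cases h : u ≤ w
  · have h1 := regIntegrable_matrixPathTerm_mul (matrixLetters_trunc_conjTranspose hL hM u.deg) n
      ⟨w, Word.le_def.1 h⟩ ⟨u, le_rfl⟩
    simp only [← trunc_ItildeMinusTerm_conjTranspose, ← trunc_Aminus_conjTranspose,
      ← conjTranspose_mul, ← map_mul] at h1
    exact h1
  · simp only [IncidenceAlgebra.apply_eq_zero_of_not_le h, map_zero]
    exact regIntegrable_zero

/-! ### The series `M`, the operator `U`, and `T`-invariance -/

variable {ι : Type*} {c : List ι → ℂ} {z σ : ι → Op X}

theorem isUnit_Mseries (hc : c [] = 1) (hz : Admissible z) : IsUnit (Mseries c z) := by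
  have hs := hz.summable_prod c
  have h : Mseries c z = 1 - (1 - Mseries c z) := by abel
  rw [h]
  refine isUnit_one_sub_of_raisesBy fun u w hne => ?_
  by_contra hlt
  refine hne ?_
  -- below degree one only the empty word contributes
  rw [IncidenceAlgebra.sub_apply, Mseries, op_tsum_apply hs, tsum_eq_single [], hc]
  · simp
  · intro l hl
    by_contra h0
    obtain ⟨i, l, rfl⟩ := List.exists_cons_of_ne_nil hl
    rw [List.map_cons, List.prod_cons] at h0
    exact hlt ((((hz.1 i).mul_right _).smul _) u w h0)

theorem isUnit_USL2 (L : Letters X) (τ : ℂ) : IsUnit (USL2 L τ) :=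
  (isUnit_opExp_smul _ _).mul (isUnit_opExp_smul _ _)

theorem USL2_add_one (L : Letters X) (τ : ℂ) : USL2 L (τ + 1) = USL2 L τ * exp2piI L.e0 := by
  rw [USL2, USL2, exp2piI, mul_assoc (opExp _), ← opExp_add_smul]
  simp [mul_add]

theorem exp2piI_mul_expNeg2piI (x : Op X) : exp2piI x * expNeg2piI x = 1 :=
  opExp_mul_opExp_neg _ x

theorem expNeg2piI_mul_exp2piI (x : Op X) : expNeg2piI x * exp2piI x = 1 :=
  opExp_neg_mul_opExp _ x

theorem inverse_USL2_add_one (L : Letters X) (τ : ℂ) :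
    Ring.inverse (USL2 L (τ + 1)) = expNeg2piI L.e0 * Ring.inverse (USL2 L τ) := by
  rw [← mul_one (Ring.inverse (USL2 L (τ + 1))),
    Ring.inverse_mul_eq_iff_eq_mul _ _ _ (isUnit_USL2 L (τ + 1)), USL2_add_one, mul_assoc,
    ← mul_assoc (exp2piI L.e0), exp2piI_mul_expNeg2piI, one_mul,
    Ring.mul_inverse_cancel _ (isUnit_USL2 L τ)]

theorem seriesWellDefined (hL : IsEisensteinMultiplets L) (hP : IsCuspMultiplets L B eP)
    (hM : IsCuspMultiplets L B eM) (hc : c [] = 1) (hz : Admissible z) (hσ : Admissible σ) :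
    SeriesWellDefined L B eP eM c z σ where
  summable_Gk k _ hτ := summable_Gk_term (le_trans (by norm_num) k.2.1) hτ
  summable_exp := op_summable_exp
  summable_Aplus τ _ := summable_AplusWt hL hP τ
  summable_Aminus τ _ := summable_AminusWt hL hM τ
  summable_Nhat := summable_NhatTerm hL
  regIntegrable_Iplus := regIntegrable_IplusTerm_mul hL hP
  regIntegrable_ItildeMinus := regIntegrable_mul_ItildeMinusTerm hL hM
  summable_Iplus τ _ := summable_IplusTerm hL hP τ
  summable_ItildeMinus τ _ := summable_ItildeMinusTerm hL hM τ
  summable_Mz := hz.summable_prod c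
  summable_Mσ := hσ.summable_prod c
  isUnit_Mz := isUnit_Mseries hc hz
  isUnit_U τ _ := isUnit_USL2 L τ

theorem tTransformation (hL : IsEisensteinMultiplets L) (hP : IsCuspMultiplets L B eP)
    (hM : IsCuspMultiplets L B eM) : TTransformation L B eP eM c z σ where
  U_T τ _ := USL2_add_one L τ
  Iplus_T _ hτ := Iplus_add_one hL hP hτ
  ItildeMinus_T _ hτ := ItildeMinus_add_one hL hM hτ
  RJeqv_T τ hτ := by
    have h : ∀ x : Op X, exp2piI L.e0 * (expNeg2piI L.e0 * x) = x := fun x => by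
      rw [← mul_assoc, exp2piI_mul_expNeg2piI, one_mul]
    rw [RJeqv, inverse_USL2_add_one, USL2_add_one, Iplus_add_one hL hP hτ,
      ItildeMinus_add_one hL hM hτ]
    simp only [mul_assoc, h]

theorem commute_Mseries {x : Op X} (h : ∀ i, Commute x (z i)) : Commute x (Mseries c z) :=
  Commute.tsum_right _ fun l => Commute.smul_right
    (Commute.list_prod_right _ _ fun y hy => by
      obtain ⟨i, -, rfl⟩ := List.mem_map.1 hy
      exact h i) _

theorem mzCondition_of_sl2Invariant (hc : c [] = 1) (hz : Admissible z)
    (h : SL2Invariant L z) : MzCondition L c z := by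
  have h1 : Commute L.e0 (Mseries c z) :=
    commute_Mseries fun i => (commute_iff_lie_eq.2 (h i).1)
  have h2 : Commute (exp2piI L.e0) (Ring.inverse (Mseries c z)) := by
    obtain ⟨m, hm⟩ := isUnit_Mseries hc hz
    rw [← hm] at h1 ⊢
    rw [Ring.inverse_unit]
    exact (Commute.opExp_smul_left h1 _).units_inv_right
  rw [MzCondition, h2.eq, mul_assoc, exp2piI_mul_expNeg2piI, mul_one]

theorem mσCondition_of_commutesWithNhat (h : CommutesWithNhat L σ) : MσCondition L c σ := by
  have h1 : Commute (Nhat L) (Mseries c σ) := commute_Mseries fun i => commute_iff_lie_eq.2 (h i)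
  have h2 : Commute (expNeg2piI (Nhat L)) (Mseries c σ) := Commute.opExp_smul_left h1 _
  rw [MσCondition, h2.eq, mul_assoc, expNeg2piI_mul_exp2piI, mul_one]

theorem tInvariant_of_conditions (h : TTransformation L B eP eM c z σ) (hz : MzCondition L c z)
    (hσ : MσCondition L c σ) : TInvariant L B eP eM c z σ := fun τ hτ => by
  rw [h.RJeqv_T τ hτ, hz, hσ, RJeqv]

/-- The properties of the generating series, for any letters with the required `sl_2`
representation theory. -/
theorem generatingSeries_properties (hL : IsEisensteinMultiplets L)
    (hP : IsCuspMultiplets L B eP) (hM : IsCuspMultiplets L B eM) (hc : c [] = 1)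
    (hz : Admissible z) (hσ : Admissible σ) :
    SeriesWellDefined L B eP eM c z σ ∧ TTransformation L B eP eM c z σ ∧
      (SL2Invariant L z → MzCondition L c z) ∧ (CommutesWithNhat L σ → MσCondition L c σ) ∧
      (MzCondition L c z → MσCondition L c σ → TInvariant L B eP eM c z σ) ∧
      (SL2Invariant L z → CommutesWithNhat L σ → TInvariant L B eP eM c z σ) := by
  have hT : TTransformation L B eP eM c z σ := tTransformation hL hP hM
  exact ⟨seriesWellDefined hL hP hM hc hz hσ, hT, mzCondition_of_sl2Invariant hc hz,
    mσCondition_of_commutesWithNhat, tInvariant_of_conditions hT, fun h1 h2 =>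
      tInvariant_of_conditions hT (mzCondition_of_sl2Invariant hc hz h1)
        (mσCondition_of_commutesWithNhat h2)⟩

end GeneratingSeries

/-! ### Operators induced by linear endomorphisms of the free algebra -/

section LinearOperators

variable {X : Type}

theorem NCPoly.monomial_eq (l : List X) :
    NCPoly.monomial l = MonoidAlgebra.single (FreeMonoid.ofList l) 1 := by
  induction l with
  | nil => rfl
  | cons x l ih =>
    rw [NCPoly.monomial, List.map_cons, List.prod_cons, ← NCPoly.monomial, ih, NCPoly.letter,
      MonoidAlgebra.of_apply, MonoidAlgebra.single_mul_single, one_mul]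
    rfl

theorem NCPoly.monomial_append (l l' : List X) :
    NCPoly.monomial (l ++ l') = NCPoly.monomial l * NCPoly.monomial l' := by
  simp [NCPoly.monomial]

theorem NCPoly.monomial_singleton (x : X) : NCPoly.monomial [x] = NCPoly.letter x := by
  simp [NCPoly.monomial]

theorem NCPoly.eq_sum (p : NCPoly X) :
    p = p.coeff.sum fun w a => a • NCPoly.monomial (FreeMonoid.toList w) := by
  conv_lhs => rw [← MonoidAlgebra.sum_coeff_single p]
  refine Finsupp.sum_congr fun w _ => ?_
  rw [NCPoly.monomial_eq, MonoidAlgebra.smul_single, smul_eq_mul, mul_one]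
  rfl

theorem NCPoly.induction_monomial {motive : NCPoly X → Prop} (p : NCPoly X)
    (zero : motive 0) (add : ∀ p q, motive p → motive q → motive (p + q))
    (smul : ∀ (a : ℂ) l, motive (a • NCPoly.monomial l)) : motive p := by
  rw [NCPoly.eq_sum p]
  exact Finset.sum_induction _ motive add zero fun w _ => smul _ _

theorem NCPoly.linearMap_ext {φ ψ : Module.End ℂ (NCPoly X)}
    (h : ∀ l, φ (NCPoly.monomial l) = ψ (NCPoly.monomial l)) : φ = ψ := by
  refine LinearMap.ext fun p => ?_
  induction p using NCPoly.induction_monomial with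
  | zero => simp
  | add p q hp hq => rw [map_add, map_add, hp, hq]
  | smul a l => rw [map_smul, map_smul, h]

theorem coeff_apply_eq_sum (φ : Module.End ℂ (NCPoly X)) (q : NCPoly X) (u : FreeMonoid X) :
    (φ q).coeff u = ∑ v ∈ q.coeff.support,
      (φ (NCPoly.monomial (FreeMonoid.toList v))).coeff u * q.coeff v := by
  conv_lhs => rw [NCPoly.eq_sum q, Finsupp.sum, map_sum, MonoidAlgebra.coeff_sum]
  rw [Finsupp.finsetSum_apply]
  refine Finset.sum_congr rfl fun v _ => ?_
  rw [map_smul, MonoidAlgebra.coeff_smul, Finsupp.smul_apply, smul_eq_mul, mul_comm]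

/-- The derivation with prescribed values on letters, as a linear map. -/
def derLinear (g : X → NCPoly X) : Module.End ℂ (NCPoly X) where
  toFun p := p.coeff.sum fun w a => a • derOnList g (FreeMonoid.toList w)
  map_add' p q := Finsupp.sum_add_index' (by simp) (by simp [add_smul])
  map_smul' a p := by
    rw [RingHom.id_apply, Finsupp.smul_sum]
    refine (Finsupp.sum_smul_index'
      (h := fun w (a : ℂ) => a • derOnList g (FreeMonoid.toList w))
      fun _ => zero_smul ℂ _).trans ?_
    simp only [smul_smul, smul_eq_mul]
    rfl

theorem derLinear_monomial (g : X → NCPoly X) (l : List X) :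
    derLinear g (NCPoly.monomial l) = derOnList g l := by
  rw [NCPoly.monomial_eq]
  refine (Finsupp.sum_single_index
    (h := fun w (a : ℂ) => a • derOnList g (FreeMonoid.toList w))
    (zero_smul ℂ _)).trans ?_
  rw [one_smul]
  rfl

theorem derLinear_letter (g : X → NCPoly X) (x : X) :
    derLinear g (NCPoly.letter x) = g x := by
  rw [← NCPoly.monomial_singleton, derLinear_monomial]
  simp [derOnList, NCPoly.monomial]

/-- The Leibniz rule. -/
def IsDer (φ : Module.End ℂ (NCPoly X)) : Prop := ∀ p q, φ (p * q) = φ p * q + p * φ q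

theorem derOnList_append (g : X → NCPoly X) (l l' : List X) :
    derOnList g (l ++ l') =
      derOnList g l * NCPoly.monomial l' + NCPoly.monomial l * derOnList g l' := by
  induction l with
  | nil => simp [derOnList, NCPoly.monomial]
  | cons x l ih =>
    rw [List.cons_append, derOnList, derOnList, ih, NCPoly.monomial_append,
      ← List.singleton_append (l := l), NCPoly.monomial_append, NCPoly.monomial_singleton]
    noncomm_ring

theorem isDer_derLinear (g : X → NCPoly X) : IsDer (derLinear g) := fun p q => by
  induction p using NCPoly.induction_monomial with
  | zero => simp
  | add p p' hp hp' =>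
    rw [add_mul, map_add, hp, hp', map_add]
    noncomm_ring
  | smul a l =>
    rw [smul_mul_assoc, map_smul, map_smul, smul_mul_assoc, smul_mul_assoc, ← smul_add]
    congr 1
    induction q using NCPoly.induction_monomial with
    | zero => simp
    | add q q' hq hq' =>
      rw [mul_add, map_add, hq, hq', map_add]
      noncomm_ring
    | smul b l' =>
      rw [mul_smul_comm, map_smul, map_smul, mul_smul_comm, mul_smul_comm, ← smul_add,
        ← NCPoly.monomial_append, derLinear_monomial, derLinear_monomial, derLinear_monomial,
        derOnList_append]

namespace IsDer

variable {φ ψ : Module.End ℂ (NCPoly X)}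

theorem apply_one (h : IsDer φ) : φ 1 = 0 := by
  have h1 := h 1 1
  simpa using h1

/-- A derivation is determined by its values on letters. -/
theorem ext (hφ : IsDer φ) (hψ : IsDer ψ)
    (h : ∀ x, φ (NCPoly.letter x) = ψ (NCPoly.letter x)) : φ = ψ :=
  NCPoly.linearMap_ext fun l => by
    induction l with
    | nil => exact hφ.apply_one.trans hψ.apply_one.symm
    | cons x l ih =>
      rw [← List.singleton_append (l := l), NCPoly.monomial_append, NCPoly.monomial_singleton,
        hφ, hψ, ih, h]

theorem lie (hφ : IsDer φ) (hψ : IsDer ψ) : IsDer ⁅φ, ψ⁆ := fun p q => by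
  simp only [Ring.lie_def, LinearMap.sub_apply, Module.End.mul_apply, hφ p q, hψ p q, map_add]
  rw [hφ, hφ, hψ, hψ]
  noncomm_ring

theorem smul (hφ : IsDer φ) (c : ℂ) : IsDer (c • φ) := fun p q => by
  simp only [LinearMap.smul_apply, hφ p q, smul_add, smul_mul_assoc, mul_smul_comm]

theorem apply_lie (hφ : IsDer φ) (p q : NCPoly X) : φ ⁅p, q⁆ = ⁅φ p, q⁆ + ⁅p, φ q⁆ := by
  simp only [Ring.lie_def, map_sub, hφ p q, hφ q p]
  abel

end IsDer

/-- All words in `p` have weight at least `n`, where the letter `x` has weight `wt x`. -/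
def MinWt (wt : X → ℕ) (n : ℕ) (p : NCPoly X) : Prop :=
  ∀ u : FreeMonoid X, p.coeff u ≠ 0 → n ≤ ((FreeMonoid.toList u).map wt).sum

namespace MinWt

variable {wt : X → ℕ} {m n : ℕ} {p q : NCPoly X}

theorem zero : MinWt wt n 0 := fun _ h => (h rfl).elim

theorem add (hp : MinWt wt n p) (hq : MinWt wt n q) : MinWt wt n (p + q) := by
  intro u h
  by_cases h1 : p.coeff u = 0
  · exact hq u fun h2 => h (by simp [h1, h2])
  · exact hp u h1

theorem smul (hp : MinWt wt n p) (c : ℂ) : MinWt wt n (c • p) := fun u h =>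
  hp u fun h2 => h (by simp [h2])

theorem sub (hp : MinWt wt n p) (hq : MinWt wt n q) : MinWt wt n (p - q) := by
  simpa [sub_eq_add_neg] using hp.add (hq.smul (-1))

theorem sum {ι : Type*} {s : Finset ι} {f : ι → NCPoly X} (h : ∀ i ∈ s, MinWt wt n (f i)) :
    MinWt wt n (∑ i ∈ s, f i) :=
  Finset.sum_induction _ _ (fun _ _ => add) zero h

theorem monomial (l : List X) : MinWt wt (l.map wt).sum (NCPoly.monomial l) := by
  intro u h
  rw [NCPoly.monomial_eq, MonoidAlgebra.coeff_single] at h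
  have h1 : u = FreeMonoid.ofList l := by
    by_contra h2
    exact h (Finsupp.single_eq_of_ne h2)
  rw [h1]
  exact le_rfl

theorem letter (x : X) : MinWt wt (wt x) (NCPoly.letter x) := by
  simpa [NCPoly.monomial_singleton] using monomial (wt := wt) [x]

theorem mul (hp : MinWt wt m p) (hq : MinWt wt n q) : MinWt wt (m + n) (p * q) := by
  classical
  rw [NCPoly.eq_sum p, NCPoly.eq_sum q, Finsupp.sum, Finsupp.sum, Finset.sum_mul_sum]
  refine sum fun u hu => sum fun v hv => ?_
  rw [smul_mul_smul_comm, ← NCPoly.monomial_append]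
  refine smul (fun x hx => ?_) _
  have h1 := monomial (wt := wt) _ x hx
  rw [List.map_append, List.sum_append] at h1
  have h2 := hp u (Finsupp.mem_support_iff.1 hu)
  have h3 := hq v (Finsupp.mem_support_iff.1 hv)
  omega

theorem mono (hp : MinWt wt n p) (h : m ≤ n) : MinWt wt m p := fun u hu => h.trans (hp u hu)

theorem lie (hp : MinWt wt m p) (hq : MinWt wt n q) : MinWt wt (m + n) ⁅p, q⁆ := by
  rw [Ring.lie_def]
  exact (hp.mul hq).sub (by simpa [add_comm] using hq.mul hp)

theorem derOnList {g : X → NCPoly X} {k : ℕ} (hg : ∀ x, MinWt wt (wt x + k) (g x)) (l : List X) :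
    MinWt wt ((l.map wt).sum + k) (derOnList g l) := by
  induction l with
  | nil => exact zero
  | cons x l ih =>
    rw [_root_.derOnList, List.map_cons, List.sum_cons]
    exact (((hg x).mul (monomial l)).mono (by omega)).add (((letter x).mul ih).mono (by omega))

end MinWt

variable [GradedAlphabet X]

/-- The operator induced by a linear endomorphism of the free algebra. -/
def linOp (φ : Module.End ℂ (NCPoly X)) : Op X := opOf fun w => φ (NCPoly.monomial w.letters)

/-- Linear endomorphisms of the free algebra that do not lower the degree. -/
def NonLowering (φ : Module.End ℂ (NCPoly X)) : Prop :=
  ∀ l : List X, MinWt GradedAlphabet.deg (l.map GradedAlphabet.deg).sum (φ (NCPoly.monomial l))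

theorem linOp_apply {φ : Module.End ℂ (NCPoly X)} (hφ : NonLowering φ) (u w : Word X) :
    linOp φ u w = (φ (NCPoly.monomial w.letters)).coeff u := by
  classical
  change (if u ≤ w then _ else _) = _
  split_ifs with h
  · rfl
  · by_contra h0
    exact h (hφ w.letters u fun h1 => h0 h1.symm)

theorem derivationOp_eq (g : X → NCPoly X) : derivationOp g = linOp (derLinear g) := by
  simp only [derivationOp, linOp, derLinear_monomial]

theorem leftMul_eq (p : NCPoly X) : leftMul p = linOp (LinearMap.mulLeft ℂ p) := rfl

theorem NonLowering.minWt {φ : Module.End ℂ (NCPoly X)} (hφ : NonLowering φ) {n : ℕ}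
    {p : NCPoly X} (hp : MinWt GradedAlphabet.deg n p) : MinWt GradedAlphabet.deg n (φ p) := by
  rw [NCPoly.eq_sum p, Finsupp.sum, map_sum]
  refine MinWt.sum fun u hu => ?_
  rw [map_smul]
  exact ((hφ _).mono (hp u (Finsupp.mem_support_iff.1 hu))).smul _

theorem NonLowering.mul {φ ψ : Module.End ℂ (NCPoly X)} (hφ : NonLowering φ)
    (hψ : NonLowering ψ) : NonLowering (φ * ψ) := fun l => hφ.minWt (hψ l)

theorem NonLowering.sub {φ ψ : Module.End ℂ (NCPoly X)} (hφ : NonLowering φ)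
    (hψ : NonLowering ψ) : NonLowering (φ - ψ) := fun l => (hφ l).sub (hψ l)

theorem NonLowering.lie {φ ψ : Module.End ℂ (NCPoly X)} (hφ : NonLowering φ)
    (hψ : NonLowering ψ) : NonLowering ⁅φ, ψ⁆ :=
  (hφ.mul hψ).sub (hψ.mul hφ)

theorem nonLowering_derLinear {g : X → NCPoly X}
    (hg : ∀ x, MinWt GradedAlphabet.deg (GradedAlphabet.deg x) (g x)) :
    NonLowering (derLinear g) := fun l => by
  rw [derLinear_monomial]
  exact MinWt.derOnList (k := 0) hg l

theorem nonLowering_mulLeft (p : NCPoly X) : NonLowering (LinearMap.mulLeft ℂ p) := fun l => by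
  have hp : MinWt GradedAlphabet.deg 0 p := fun _ _ => Nat.zero_le _
  simpa using hp.mul (MinWt.monomial l)

theorem linOp_mul {φ ψ : Module.End ℂ (NCPoly X)} (hφ : NonLowering φ) (hψ : NonLowering ψ) :
    linOp (φ * ψ) = linOp φ * linOp ψ := by
  classical
  ext u w huw
  rw [linOp_apply (hφ.mul hψ), IncidenceAlgebra.mul_apply, Module.End.mul_apply]
  simp only [linOp_apply hφ, linOp_apply hψ]
  set q := ψ (NCPoly.monomial w.letters) with hq
  refine (coeff_apply_eq_sum φ q u).trans
    (Finset.sum_congr_of_eq_on_inter (ι := Word X) (s₁ := q.coeff.support)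
      (s₂ := Finset.Icc u w) ?_ ?_ ?_)
  · intro v hv hv'
    by_contra h0
    refine hv' (Finset.mem_Icc.2 ⟨?_, ?_⟩)
    · exact hφ (FreeMonoid.toList v) u (left_ne_zero_of_mul h0)
    · exact hψ w.letters v (right_ne_zero_of_mul h0)
  · intro v _ hv'
    exact mul_eq_zero_of_right _ (Finsupp.notMem_support_iff.1 hv')
  · exact fun _ _ _ => rfl

theorem linOp_sub (φ ψ : Module.End ℂ (NCPoly X)) : linOp (φ - ψ) = linOp φ - linOp ψ := by
  classical
  ext u w huw
  simp [linOp, opOf, huw]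
  rfl

theorem linOp_smul (c : ℂ) (φ : Module.End ℂ (NCPoly X)) : linOp (c • φ) = c • linOp φ := by
  classical
  ext u w huw
  simp [linOp, opOf, huw]
  rfl

theorem linOp_zero : linOp (0 : Module.End ℂ (NCPoly X)) = 0 := by
  simpa using linOp_smul 0 (0 : Module.End ℂ (NCPoly X))

theorem linOp_lie {φ ψ : Module.End ℂ (NCPoly X)} (hφ : NonLowering φ) (hψ : NonLowering ψ) :
    linOp ⁅φ, ψ⁆ = ⁅linOp φ, linOp ψ⁆ := by
  rw [Ring.lie_def, Ring.lie_def, linOp_sub, linOp_mul hφ hψ, linOp_mul hψ hφ]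

theorem linOp_raisesBy {φ : Module.End ℂ (NCPoly X)} (hφ : NonLowering φ) {n : ℕ}
    (h : ∀ l : List X, MinWt GradedAlphabet.deg ((l.map GradedAlphabet.deg).sum + n)
      (φ (NCPoly.monomial l))) : RaisesBy n (linOp φ) := fun u w hne => by
  rw [linOp_apply hφ] at hne
  exact h w.letters u hne

end LinearOperators

/-! ### The free letters -/

section FreeCase

variable (M : Type) [ExtraMultiplets M]

/-- The values of `e_0` on the free letters. -/
def freeE0 (x : FreeAlphabet M) : NCPoly (FreeAlphabet M) :=
  if h : x.2.1 + 1 < multipletDim M x.1 then NCPoly.letter ⟨x.1, ⟨x.2.1 + 1, h⟩⟩ else 0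

theorem lie_derLinear_mulLeft {X : Type} (g : X → NCPoly X) (p : NCPoly X) :
    ⁅derLinear g, LinearMap.mulLeft ℂ p⁆ = LinearMap.mulLeft ℂ (derLinear g p) := by
  refine LinearMap.ext fun q => ?_
  rw [Ring.lie_def, LinearMap.sub_apply, Module.End.mul_apply, Module.End.mul_apply,
    LinearMap.mulLeft_apply, LinearMap.mulLeft_apply, LinearMap.mulLeft_apply,
    isDer_derLinear g p q, add_sub_cancel_right]

theorem lie_e0_leftMul (p : NCPoly (FreeAlphabet M)) :
    ⁅(freeLetters M).e0, leftMul p⁆ = leftMul (derLinear (freeE0 M) p) := by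
  have h0 : (freeLetters M).e0 = linOp (derLinear (freeE0 M)) := derivationOp_eq _
  have hnl : NonLowering (derLinear (freeE0 M)) := nonLowering_derLinear fun x => by
    rw [freeE0]
    split_ifs with h
    · exact MinWt.letter (wt := GradedAlphabet.deg)
        (⟨x.1, ⟨x.2.1 + 1, h⟩⟩ : FreeAlphabet M)
    · exact MinWt.zero
  rw [h0, leftMul_eq, leftMul_eq, ← linOp_lie hnl (nonLowering_mulLeft p), lie_derLinear_mulLeft]

theorem adPow_e0_freeLetters (k : EvenWt) (j : ℕ) (hj : j < multipletDim M (.inl k)) :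
    adPow (freeLetters M).e0 j ((freeLetters M).e k) =
      leftMul (NCPoly.letter ⟨.inl k, ⟨j, hj⟩⟩) := by
  induction j with
  | zero => rfl
  | succ j ih =>
    rw [adPow, Function.iterate_succ_apply', ← adPow, ih (by omega), lie_e0_leftMul,
      derLinear_letter, freeE0, dif_pos hj]

/-- The multiplet of left multiplications by `e_k^{(j)}` ends with `j = k - 2` by definition. -/
theorem isEisensteinMultiplets_freeLetters : IsEisensteinMultiplets (freeLetters M) where
  raises k := by
    refine linOp_raisesBy (nonLowering_mulLeft _) fun l => ?_
    rw [add_comm]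
    exact MinWt.mul (m := k.1) (MinWt.letter (wt := GradedAlphabet.deg)
      (⟨.inl k, ⟨0, by have := k.2.1; simp only [multipletDim]; omega⟩⟩ : FreeAlphabet M))
      (MinWt.monomial l)
  nilpotent k := by
    have hk : multipletDim M (.inl k) = k.1 - 1 := rfl
    have hk4 := k.2.1
    obtain ⟨j, hj⟩ : ∃ j, k.1 - 1 = j + 1 := ⟨k.1 - 2, by omega⟩
    rw [hj, adPow, Function.iterate_succ_apply', ← adPow,
      adPow_e0_freeLetters M k j (by omega), lie_e0_leftMul, derLinear_letter, freeE0,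
      dif_neg (by simp only; omega), leftMul_eq, LinearMap.mulLeft_zero_eq_zero, linOp_zero]

end FreeCase

/-! ### Tsunogai's derivations -/

section Sl2

variable {R : Type} [Ring R]

theorem lie_lie_ring (a b c : R) : ⁅a, ⁅b, c⁆⁆ = ⁅⁅a, b⁆, c⁆ + ⁅b, ⁅a, c⁆⁆ := by
  simp only [Ring.lie_def]
  noncomm_ring

variable [Algebra ℂ R]

theorem smul_lie_ring (c : ℂ) (a b : R) : ⁅c • a, b⁆ = c • ⁅a, b⁆ := by
  simp only [Ring.lie_def, smul_mul_assoc, mul_smul_comm, smul_sub]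

theorem lie_smul_ring (c : ℂ) (a b : R) : ⁅a, c • b⁆ = c • ⁅a, b⁆ := by
  simp only [Ring.lie_def, smul_mul_assoc, mul_smul_comm, smul_sub]

/-- The standard `sl_2` computation on the multiplet generated from a vector `x` of weight `μ`
that is annihilated by `e`. -/
theorem lie_adPow_succ {e f h x : R} {μ : ℂ} (hef : ⁅e, f⁆ = h) (hhf : ⁅h, f⁆ = (-2 : ℂ) • f)
    (hhx : ⁅h, x⁆ = μ • x) (hex : ⁅e, x⁆ = 0) (n : ℕ) :
    ⁅e, adPow f (n + 1) x⁆ = (((n : ℂ) + 1) * (μ - n)) • adPow f n x := by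
  have hsucc : ∀ n, adPow f (n + 1) x = ⁅f, adPow f n x⁆ := fun n =>
    Function.iterate_succ_apply' _ _ _
  have hw : ∀ n : ℕ, ⁅h, adPow f n x⁆ = (μ - 2 * n) • adPow f n x := fun n => by
    induction n with
    | zero => simpa [adPow] using hhx
    | succ n ih =>
      rw [hsucc, lie_lie_ring, ih, hhf, smul_lie_ring, lie_smul_ring, ← add_smul]
      congr 1
      push_cast
      ring
  induction n with
  | zero =>
    rw [hsucc, lie_lie_ring, hef]
    have h0 : adPow f 0 x = x := rfl
    rw [h0, hhx, hex]
    simp [Ring.lie_def]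
  | succ n ih =>
    rw [hsucc (n + 1), lie_lie_ring, hef, hw, ih, lie_smul_ring, ← hsucc, ← add_smul]
    congr 1
    push_cast
    ring

theorem exists_adPow_eq_zero {f : R} (hf : IsNilpotent f) (x : R) :
    ∃ n, ∀ j, adPow f (j + n) x = 0 := by
  let _ : LieRing R := LieRing.ofAssociativeRing
  obtain ⟨n, hn⟩ := LieAlgebra.ad_nilpotent_of_nilpotent (R := ℂ) hf
  have hpow : ∀ j, adPow f j x = ((LieAlgebra.ad ℂ R f) ^ j) x := fun j => by
    rw [Module.End.pow_apply]
    rfl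
  exact ⟨n, fun j => by rw [hpow, pow_add, hn, mul_zero, LinearMap.zero_apply]⟩

/-- If moreover `f` is nilpotent and `μ = m` is a natural number, then the multiplet has dimension
at most `m + 1`: `e` maps its elements injectively downwards from step `m + 1` on. -/
theorem adPow_eq_zero_of_isNilpotent {e f h x : R} {m : ℕ} (hf : IsNilpotent f)
    (hef : ⁅e, f⁆ = h) (hhf : ⁅h, f⁆ = (-2 : ℂ) • f) (hhx : ⁅h, x⁆ = (m : ℂ) • x)
    (hex : ⁅e, x⁆ = 0) : adPow f (m + 1) x = 0 := by
  obtain ⟨n, hn⟩ := exists_adPow_eq_zero hf x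
  have hlarge : adPow f (m + 1 + n) x = 0 := hn _
  clear hn
  induction n with
  | zero => exact hlarge
  | succ n ih =>
    refine ih ?_
    have h1 := lie_adPow_succ hef hhf hhx hex (m + 1 + n)
    rw [add_assoc (m + 1), hlarge] at h1
    refine (smul_eq_zero.1 (h1.symm.trans (by simp [Ring.lie_def]))).resolve_left
      (mul_ne_zero (Nat.cast_add_one_ne_zero _) ?_)
    rw [sub_ne_zero]
    exact_mod_cast (by omega : m ≠ m + 1 + n)

end Sl2

theorem MatrixRaises.isNilpotent {S : Type} [Fintype S] [DecidableEq S] {d : S → ℕ}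
    {M : Matrix S S ℂ} (h : MatrixRaises d 1 M) : IsNilpotent M := by
  have hpow : ∀ n, MatrixRaises d n (M ^ n) := fun n => by
    induction n with
    | zero =>
      intro u w hne
      rw [pow_zero, Matrix.one_apply] at hne
      rw [show u = w from by_contra fun h' => hne (if_neg h')]
      exact le_rfl
    | succ n ih => exact pow_succ M n ▸ ih.mul h
  obtain ⟨b, hb⟩ := (Set.finite_range d).bddAbove
  refine ⟨b + 1, ?_⟩
  ext u w
  by_contra hne
  have h1 := hpow (b + 1) u w hne
  have h2 := hb ⟨u, rfl⟩
  omega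

section Tsunogai

open TorusLetter

/-- The letter `a`. -/
abbrev torusA : NCPoly TorusLetter := NCPoly.letter a

/-- The letter `b`. -/
abbrev torusB : NCPoly TorusLetter := NCPoly.letter b

/-- The elements `ad_a^j b`, which span the degree-one part in `b` of the free Lie algebra. -/
abbrev adAB (j : ℕ) : NCPoly TorusLetter := adPow torusA j torusB

/-- `ε_0` on letters. -/
def tsunogaiE0 (x : TorusLetter) : NCPoly TorusLetter :=
  match x with
  | .a => torusB
  | .b => 0

/-- `ε_0^∨` on letters. -/
def tsunogaiE0v (x : TorusLetter) : NCPoly TorusLetter :=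
  match x with
  | .a => 0
  | .b => torusA

/-- `ε_k` on letters. -/
def tsunogaiE (k : ℕ) (x : TorusLetter) : NCPoly TorusLetter :=
  match x with
  | .a => adAB k
  | .b => ∑ j ∈ Finset.range (k / 2), (-1 : ℂ) ^ j • ⁅adAB j, adAB (k - 1 - j)⁆

/-- The weight operator `[ε_0^∨, ε_0]`, on letters. -/
def tsunogaiH (x : TorusLetter) : NCPoly TorusLetter :=
  match x with
  | .a => torusA
  | .b => (-1 : ℂ) • torusB

theorem adAB_succ (j : ℕ) : adAB (j + 1) = ⁅torusA, adAB j⁆ :=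
  Function.iterate_succ_apply' _ _ _

theorem lie_tsunogaiE0v_tsunogaiE0 :
    ⁅derLinear tsunogaiE0v, derLinear tsunogaiE0⁆ = derLinear tsunogaiH := by
  refine ((isDer_derLinear _).lie (isDer_derLinear _)).ext (isDer_derLinear _) fun x => ?_
  cases x <;>
    simp [Ring.lie_def, derLinear_letter, tsunogaiE0v, tsunogaiE0, tsunogaiH]

theorem lie_tsunogaiH_tsunogaiE0 :
    ⁅derLinear tsunogaiH, derLinear tsunogaiE0⁆ = (-2 : ℂ) • derLinear tsunogaiE0 := by
  refine ((isDer_derLinear _).lie (isDer_derLinear _)).ext ((isDer_derLinear _).smul _)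
    fun x => ?_
  cases x
  · simp [Ring.lie_def, derLinear_letter, tsunogaiE0, tsunogaiH]
    module
  · simp [Ring.lie_def, derLinear_letter, tsunogaiE0, tsunogaiH]

theorem derLinear_tsunogaiH_adAB (j : ℕ) :
    derLinear tsunogaiH (adAB j) = ((j : ℂ) - 1) • adAB j := by
  induction j with
  | zero => simp [adPow, derLinear_letter, tsunogaiH]
  | succ j ih =>
    rw [adAB_succ, (isDer_derLinear _).apply_lie, ih, derLinear_letter, lie_smul_ring]
    simp only [tsunogaiH]
    push_cast
    module

theorem derLinear_tsunogaiE0v_adAB (j : ℕ) : derLinear tsunogaiE0v (adAB (j + 1)) = 0 := by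
  induction j with
  | zero =>
    rw [adAB_succ, (isDer_derLinear _).apply_lie, derLinear_letter]
    have h0 : adAB 0 = torusB := rfl
    rw [h0, derLinear_letter]
    simp [tsunogaiE0v, Ring.lie_def]
  | succ j ih =>
    rw [adAB_succ, (isDer_derLinear _).apply_lie, derLinear_letter, ih]
    simp [tsunogaiE0v, Ring.lie_def]

theorem lie_tsunogaiH_tsunogaiE {k m : ℕ} (hk : k = m + 2) :
    ⁅derLinear tsunogaiH, derLinear (tsunogaiE k)⁆ = (m : ℂ) • derLinear (tsunogaiE k) := by
  refine ((isDer_derLinear _).lie (isDer_derLinear _)).ext ((isDer_derLinear _).smul _)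
    fun x => ?_
  rw [Ring.lie_def, LinearMap.sub_apply, Module.End.mul_apply, Module.End.mul_apply,
    LinearMap.smul_apply, derLinear_letter, derLinear_letter]
  cases x
  · simp only [tsunogaiE, tsunogaiH, derLinear_letter, derLinear_tsunogaiH_adAB, hk]
    push_cast
    module
  · simp only [tsunogaiE, tsunogaiH, map_smul, derLinear_letter, map_sum, Finset.smul_sum,
      ← Finset.sum_sub_distrib]
    refine Finset.sum_congr rfl fun j hj => ?_
    obtain ⟨i, hi⟩ : ∃ i, k - 1 = j + i :=
      ⟨k - 1 - j, by have := Finset.mem_range.1 hj; omega⟩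
    have hm : (m : ℂ) = j + i - 1 := by
      rw [eq_sub_iff_add_eq]
      exact_mod_cast (by omega : m + 1 = j + i)
    rw [hi, Nat.add_sub_cancel_left, (isDer_derLinear _).apply_lie, derLinear_tsunogaiH_adAB,
      derLinear_tsunogaiH_adAB, lie_smul_ring, smul_lie_ring, hm]
    module

/-- Only the summand `j = 0` of `ε_k (b)` is not annihilated by `ε_0^∨`, and its image is
`ad_a^k b = ε_k (ε_0^∨ (b))`. -/
theorem lie_tsunogaiE0v_tsunogaiE {k : ℕ} (hk : 4 ≤ k) :
    ⁅derLinear tsunogaiE0v, derLinear (tsunogaiE k)⁆ = 0 := by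
  refine ((isDer_derLinear _).lie (isDer_derLinear _)).ext (fun p q => by simp) fun x => ?_
  rw [Ring.lie_def, LinearMap.sub_apply, Module.End.mul_apply, Module.End.mul_apply,
    LinearMap.zero_apply, derLinear_letter, derLinear_letter]
  have hpos : ∀ {j : ℕ}, 0 < j → derLinear tsunogaiE0v (adAB j) = 0 := fun {j} hj => by
    obtain ⟨i, rfl⟩ := Nat.exists_eq_add_of_lt hj
    rw [zero_add]
    exact derLinear_tsunogaiE0v_adAB i
  cases x
  · simp only [tsunogaiE, tsunogaiE0v, map_zero, sub_zero]
    exact hpos (by omega)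
  · simp only [tsunogaiE, tsunogaiE0v, map_sum, map_smul, derLinear_letter]
    rw [Finset.sum_eq_single_of_mem 0 (Finset.mem_range.2 (by omega))]
    · obtain ⟨i, rfl⟩ : ∃ i, k = i + 1 := ⟨k - 1, by omega⟩
      have h0 : adAB 0 = torusB := rfl
      rw [(isDer_derLinear _).apply_lie, h0, derLinear_letter, hpos (by omega), adAB_succ]
      simp [tsunogaiE0v, Ring.lie_def]
    · intro j hj hj0
      have := Finset.mem_range.1 hj
      rw [(isDer_derLinear _).apply_lie, hpos (by omega), hpos (by omega)]
      simp [Ring.lie_def]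

theorem minWt_adAB (j : ℕ) : MinWt GradedAlphabet.deg (j + 1) (adAB j) := by
  induction j with
  | zero => exact MinWt.letter (wt := GradedAlphabet.deg) b
  | succ j ih =>
    rw [adAB_succ, add_comm]
    exact (MinWt.letter (wt := GradedAlphabet.deg) a).lie ih

theorem minWt_tsunogaiE (k : ℕ) (x : TorusLetter) :
    MinWt GradedAlphabet.deg (GradedAlphabet.deg x + k) (tsunogaiE k x) := by
  cases x
  · exact (minWt_adAB k).mono (add_comm 1 k).le
  · refine MinWt.sum fun j hj => ((minWt_adAB j).lie (minWt_adAB (k - 1 - j))).mono ?_ |>.smul _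
    have := Finset.mem_range.1 hj
    change 1 + k ≤ _
    omega

theorem nonLowering_tsunogaiE0 : NonLowering (derLinear tsunogaiE0) :=
  nonLowering_derLinear fun x => by
    cases x
    · exact MinWt.letter (wt := GradedAlphabet.deg) b
    · exact MinWt.zero

theorem nonLowering_tsunogaiE0v : NonLowering (derLinear tsunogaiE0v) :=
  nonLowering_derLinear fun x => by
    cases x
    · exact MinWt.zero
    · exact MinWt.letter (wt := GradedAlphabet.deg) a

theorem nonLowering_tsunogaiE (k : ℕ) : NonLowering (derLinear (tsunogaiE k)) :=
  nonLowering_derLinear fun x => (minWt_tsunogaiE k x).mono (Nat.le_add_right _ _)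

theorem nonLowering_tsunogaiH : NonLowering (derLinear tsunogaiH) := by
  rw [← lie_tsunogaiE0v_tsunogaiE0]
  exact nonLowering_tsunogaiE0v.lie nonLowering_tsunogaiE0

theorem tsunogaiLetters_e0 : tsunogaiLetters.e0 = linOp (derLinear tsunogaiE0) := by
  rw [← derivationOp_eq]
  change derivationOp _ = derivationOp _
  congr 1

theorem tsunogaiLetters_e (k : EvenWt) :
    tsunogaiLetters.e k = linOp (derLinear (tsunogaiE k.1)) := by
  rw [← derivationOp_eq]
  change derivationOp _ = derivationOp _
  congr 1

/-- On words of bounded degree `ε_0` is nilpotent, since it raises the number of letters `b`. -/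
theorem isNilpotent_trunc_tsunogaiE0 (N : ℕ) :
    IsNilpotent (trunc N (linOp (derLinear tsunogaiE0))) := by
  let wt : TorusLetter → ℕ := fun x => match x with
    | .a => 0
    | .b => 1
  refine MatrixRaises.isNilpotent (d := fun u : LowWord TorusLetter N => (u.1.letters.map wt).sum)
    fun u w hne => ?_
  rw [trunc_apply, linOp_apply nonLowering_tsunogaiE0, derLinear_monomial] at hne
  refine MinWt.derOnList (wt := wt) (k := 1) (fun x => ?_) w.1.letters u.1 hne
  cases x
  · exact MinWt.letter (wt := wt) b
  · exact MinWt.zero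

/-- `ε_k` is annihilated by `ad ε_0^∨` and has weight `k - 2`, so its multiplet has dimension at
most `k - 1`, provided it is finite; it is so on words of bounded degree. -/
theorem isEisensteinMultiplets_tsunogaiLetters : IsEisensteinMultiplets tsunogaiLetters where
  raises k := by
    rw [tsunogaiLetters_e]
    refine linOp_raisesBy (nonLowering_tsunogaiE _) fun l => ?_
    rw [derLinear_monomial]
    exact MinWt.derOnList (minWt_tsunogaiE k.1) l
  nilpotent k := by
    have hk4 := k.2.1
    obtain ⟨m, hm⟩ : ∃ m, k.1 = m + 2 := ⟨k.1 - 2, by omega⟩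
    have trunc_lie : ∀ {N : ℕ} {φ ψ : Module.End ℂ (NCPoly TorusLetter)}, NonLowering φ →
        NonLowering ψ →
        ⁅trunc N (linOp φ), trunc N (linOp ψ)⁆ = trunc N (linOp ⁅φ, ψ⁆) := fun hφ hψ => by
      rw [linOp_lie hφ hψ, Ring.lie_def, Ring.lie_def, map_sub, map_mul, map_mul]
    refine op_ext_trunc fun N => ?_
    rw [tsunogaiLetters_e, tsunogaiLetters_e0, trunc_adPow, map_zero,
      show k.1 - 1 = m + 1 by omega]
    refine adPow_eq_zero_of_isNilpotent (isNilpotent_trunc_tsunogaiE0 N)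
      (trunc_lie nonLowering_tsunogaiE0v nonLowering_tsunogaiE0) ?_ ?_ ?_
    · rw [lie_tsunogaiE0v_tsunogaiE0, trunc_lie nonLowering_tsunogaiH nonLowering_tsunogaiE0,
        lie_tsunogaiH_tsunogaiE0, linOp_smul, map_smul]
    · rw [lie_tsunogaiE0v_tsunogaiE0, trunc_lie nonLowering_tsunogaiH (nonLowering_tsunogaiE _),
        lie_tsunogaiH_tsunogaiE hm, linOp_smul, map_smul]
    · rw [trunc_lie nonLowering_tsunogaiE0v (nonLowering_tsunogaiE _),
        lie_tsunogaiE0v_tsunogaiE hk4, linOp_zero, map_zero]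

end Tsunogai

theorem isCuspMultiplets_empty {X : Type} [GradedAlphabet X] (L : Letters X)
    (eD : CuspLetters X) : IsCuspMultiplets L (fun _ => ∅) eD where
  lowest _ _ h := absurd h (Finset.notMem_empty _)
  nilpotent _ _ h := absurd h (Finset.notMem_empty _)
  admissible :=
    ⟨fun p => absurd p.2.2 (Finset.notMem_empty _), fun _ =>
      Set.Finite.subset Set.finite_empty fun p _ => absurd p.2.2 (Finset.notMem_empty _)⟩

end

theorem mainTheorem4 :
    -- free letters `e_k`, with cusp forms and generators `ẑ`, `σ̂` for odd weights and new periods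
    (∀ (M : Type) [ExtraMultiplets M] (B : CuspForms) (eP eM : CuspLetters (FreeAlphabet M)),
      IsCuspMultiplets (freeLetters M) B eP → IsCuspMultiplets (freeLetters M) B eM →
      ∀ (Ω : Type*) (c : List (OddWt ⊕ Ω) → ℂ) (z σ : OddWt ⊕ Ω → Op (FreeAlphabet M)),
      c [] = 1 → Admissible z → Admissible σ →
        SeriesWellDefined (freeLetters M) B eP eM c z σ ∧
        TTransformation (freeLetters M) B eP eM c z σ ∧
        (SL2Invariant (freeLetters M) z → MzCondition (freeLetters M) c z) ∧
        (CommutesWithNhat (freeLetters M) σ → MσCondition (freeLetters M) c σ) ∧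
        (MzCondition (freeLetters M) c z → MσCondition (freeLetters M) c σ →
          TInvariant (freeLetters M) B eP eM c z σ) ∧
        (SL2Invariant (freeLetters M) z → CommutesWithNhat (freeLetters M) σ →
          TInvariant (freeLetters M) B eP eM c z σ)) ∧
    -- Tsunogai's derivations, without cusp forms and new periods
    (∀ (c : List OddWt → ℂ) (z σ : OddWt → Op TorusLetter),
      c [] = 1 → Admissible z → Admissible σ →
        SeriesWellDefined tsunogaiLetters (fun _ => ∅) 0 0 c z σ ∧
        TTransformation tsunogaiLetters (fun _ => ∅) 0 0 c z σ ∧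
        (SL2Invariant tsunogaiLetters z → MzCondition tsunogaiLetters c z) ∧
        (CommutesWithNhat tsunogaiLetters σ → MσCondition tsunogaiLetters c σ) ∧
        (MzCondition tsunogaiLetters c z → MσCondition tsunogaiLetters c σ →
          TInvariant tsunogaiLetters (fun _ => ∅) 0 0 c z σ) ∧
        (SL2Invariant tsunogaiLetters z → CommutesWithNhat tsunogaiLetters σ →
          TInvariant tsunogaiLetters (fun _ => ∅) 0 0 c z σ)) := by
  refine ⟨fun M _ B eP eM hP hM Ω c z σ hc hz hσ => ?_, fun c z σ hc hz hσ => ?_⟩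
  · exact generatingSeries_properties (isEisensteinMultiplets_freeLetters M) hP hM hc hz hσ
  · exact generatingSeries_properties isEisensteinMultiplets_tsunogaiLetters
      (isCuspMultiplets_empty _ 0) (isCuspMultiplets_empty _ 0) hc hz hσ
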